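/- Let $G$ be a finite simple graph. The maximum average degree of $G$ is $\mathrm{mad}(G) := \max_{H} 2|E(H)|/|V(H)|$, where $H$ ranges over all nonempty subgraphs of $G$. A $6$-assignment $L$ for $G$ gives each vertex $v$ a list $L(v)$ of exactly $6$ allowable colors; an $L$-coloring is a proper coloring $\alpha$ of $G$ with $\alpha(v)\in L(v)$ for every vertex $v$. An $L$-recoloring sequence transforming $\alpha$ to $\beta$ is a finite sequence of $L$-colorings, beginning with $\alpha$ and ending with $\beta$, in which any two consecutive colorings differ on exactly one vertex (the vertex recolored at that step). If $\mathrm{mad}(G)<17/5$, then for every $6$-assignment $L$ for $G$ and all $L$-colorings $\alpha$ and $\beta$ of $G$, there is an $L$-recoloring sequence that transforms $\alpha$ to $\beta$ and recolors each vertex at most $12$ times. In particular, the same conclusion holds for every planar graph $G$ of girth at least $5$ (where an acyclic graph has girth $\infty$). -/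

import Mathlib

namespace SparseRecoloring

section Coloring

variable {V : Type*} {C : Type*}

/-- A `k`-assignment: every vertex gets a list of exactly `k` allowable colors. -/
def IsKAssignment (k : ℕ) (L : V → Finset C) : Prop :=
  ∀ v, (L v).card = k

/-- The `L`-colorings of `G`: the proper colorings `α` with `α v ∈ L v` for every vertex `v`. -/
abbrev LColoring (G : SimpleGraph V) (L : V → Finset C) :=
  {α : G.Coloring C // ∀ v, α v ∈ L v}

/-- The `L`-recoloring graph of `G`: its vertices are the `L`-colorings of `G`, and two of them are
adjacent if they differ on exactly one vertex of `G`. -/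
def recoloringGraph (G : SimpleGraph V) (L : V → Finset C) : SimpleGraph (LColoring G L) where
  Adj α β := ∃! v, α.1 v ≠ β.1 v
  symm := ⟨by
    intro α β h
    simpa only [ne_comm] using h⟩
  loopless := ⟨by
    rintro α ⟨v, hv, -⟩
    exact hv rfl⟩

/-- An `L`-recoloring sequence transforming `α` into `β`: consecutive colorings are `L`-colorings
that differ on exactly one vertex. -/
abbrev RecoloringSequence (G : SimpleGraph V) (L : V → Finset C) (α β : LColoring G L) :=
  (recoloringGraph G L).Walk α β

open Classical in
/-- The number of times that the recoloring sequence `σ` recolors the vertex `v`. -/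
noncomputable def timesRecolored {G : SimpleGraph V} {L : V → Finset C} {α β : LColoring G L}
    (σ : RecoloringSequence G L α β) (v : V) : ℕ :=
  σ.darts.countP (fun d => d.fst.1 v ≠ d.snd.1 v)

/-- A recoloring sequence is `k`-good if it recolors each vertex at most `k` times. -/
def IsGood {G : SimpleGraph V} {L : V → Finset C} {α β : LColoring G L}
    (k : ℕ) (σ : RecoloringSequence G L α β) : Prop :=
  ∀ v, timesRecolored σ v ≤ k

end Coloring

section Mad

/-- The maximum average degree of a (finite) graph: the maximum of `2|E(H)|/|V(H)|` over all
nonempty subgraphs `H` of `G`. A finite graph has finitely many subgraphs, so that the supremum is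
a maximum; it is `0` for the graph without vertices. -/
noncomputable def mad {V : Type*} (G : SimpleGraph V) : ℝ :=
  ⨆ H : {H : G.Subgraph // H.verts.Nonempty},
    2 * (H.1.edgeSet.ncard : ℝ) / (H.1.verts.ncard : ℝ)

end Mad

section Planar

/-- The Euclidean plane. -/
abbrev Plane := EuclideanSpace ℝ (Fin 2)

/-- `A` is a (simple) polygonal arc from `a` to `b`: the union of the segments
`[p 0, p 1], …, [p (n - 1), p n]` with `p 0 = a` and `p n = b`, all of positive length, where
consecutive segments meet only in their common endpoint and all others are disjoint. -/
def IsPolygonalArc (a b : Plane) (A : Set Plane) : Prop :=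
  ∃ (n : ℕ) (p : ℕ → Plane),
    0 < n ∧ p 0 = a ∧ p n = b ∧
    (∀ i < n, p i ≠ p (i + 1)) ∧
    (∀ i, i + 1 < n →
      segment ℝ (p i) (p (i + 1)) ∩ segment ℝ (p (i + 1)) (p (i + 2)) = {p (i + 1)}) ∧
    (∀ i j, i + 1 < j → j < n →
      Disjoint (segment ℝ (p i) (p (i + 1))) (segment ℝ (p j) (p (j + 1)))) ∧
    A = ⋃ i ∈ Set.Iio n, segment ℝ (p i) (p (i + 1))

/-- A planar embedding (crossing-free drawing) of `G`: distinct vertices are distinct points of the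
plane, each edge is a polygonal arc joining its ends, an arc contains no vertex other than its two
ends, and two distinct arcs meet only in common ends. -/
structure PlanarEmbedding {V : Type*} (G : SimpleGraph V) where
  /-- the point representing a vertex -/
  pos : V → Plane
  /-- the arc representing an edge (irrelevant for pairs that are not edges) -/
  arc : Sym2 V → Set Plane
  pos_injective : Function.Injective pos
  isPolygonalArc : ∀ u v, G.Adj u v → IsPolygonalArc (pos u) (pos v) (arc s(u, v))
  vertex_mem_arc : ∀ e ∈ G.edgeSet, ∀ w, pos w ∈ arc e → w ∈ e
  arc_inter : ∀ e ∈ G.edgeSet, ∀ f ∈ G.edgeSet, e ≠ f →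
    ∀ x ∈ arc e ∩ arc f, ∃ w, w ∈ e ∧ w ∈ f ∧ x = pos w

/-- A (finite) graph is planar if it can be drawn in the plane without crossings. -/
def IsPlanar {V : Type*} (G : SimpleGraph V) : Prop :=
  Nonempty (PlanarEmbedding G)

end Planar

end SparseRecoloring

/-! Both hypotheses are used only through `IsSparse`. Discharging (`exists_star`) turns it into
unavoidable configurations: every nonempty induced subgraph has a vertex of degree at most 2, a
3-vertex with two 3-neighbors, or a 4-vertex with only 3-neighbors. Such a configuration is deleted,
the rest is recolored by induction with at most 12 moves per vertex, and the sequence is extended to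
the deleted vertices.

To extend, the moves of the rest are replayed. When a neighbor is about to take the color of a
deleted vertex `x`, first `x` moves to a color that is absent from its neighborhood and, by
pigeonhole (`exists_color`), is not used by the next few moves of its neighbors: with `k + 1`
available colors it can skip `k` further moves. A vertex of degree at most 2 has three available
colors, so it moves once per three neighbor moves, at most 24/3 times, and once more at the end.

A 3-vertex `x` next to a deleted center `u` has only two available colors, and 24/2 moves plus a
final one is too many. At its first two conflicts `x` therefore ignores the color of `u`, which
gives a third color; if `u` holds the chosen color, `u` is displaced first. This leaves 2 + 9 moves
for `x` and charges at most two displacements per leaf to `u` (`extend_star`). At the end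
`exists_finish` moves the center and leaves to their targets. The totals stay at most 12
(`reachable_of_star`).

For planar graphs, Euler's inequality |E| ≤ |V| + |F| comes from linear algebra over the field with
two elements: the boundary map has rank at most |V|, and its kernel embeds into functions on faces
by counting crossings with a vertical ray modulo 2 (`card_edgeSet_le`). Without 3- and 4-cycles, and
with minimum degree at least 2, every face lies on the right of five oriented edges
(`five_le_card_face`). Hence 3|E| ≤ 5|V|, and the average degree is at most 10/3 < 17/5. -/

namespace SparseRecoloring

open Classical Topology

/-! ### Recoloring sequences of induced subgraphs as lists of moves -/

section Moves

variable {V : Type*} {C : Type*} (G : SimpleGraph V) (L : V → Finset C)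

/-- `f` restricts to an `L`-coloring of the subgraph of `G` induced by `W`. -/
structure ProperOn (W : Finset V) (f : V → C) : Prop where
  mem : ∀ v ∈ W, f v ∈ L v
  ne : ∀ v ∈ W, ∀ w ∈ W, G.Adj v w → f v ≠ f w

/-- In the coloring `f` of `G[W]`, the vertex `v` may be recolored with `c`. -/
def CanMove (W : Finset V) (f : V → C) (v : V) (c : C) : Prop :=
  v ∈ W ∧ c ∈ L v ∧ ∀ w ∈ W, G.Adj v w → f w ≠ c

/-- The coloring obtained from `f` by a list of moves. -/
noncomputable def run : (V → C) → List (V × C) → V → C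
  | f, [] => f
  | f, m :: ms => run (Function.update f m.1 m.2) ms

/-- All moves of the list are legal in `G[W]` when started from `f`. -/
def ValidMoves (W : Finset V) : (V → C) → List (V × C) → Prop
  | _, [] => True
  | f, m :: ms => CanMove G L W f m.1 m.2 ∧ ValidMoves W (Function.update f m.1 m.2) ms

/-- The number of moves of the vertex `v`. -/
noncomputable def cnt (ms : List (V × C)) (v : V) : ℕ := ms.countP (fun m => m.1 = v)

/-- `g` can be reached from `f` by legal moves in `G[W]`, with `v` moved at most `n v` times. -/
def Reach (W : Finset V) (f g : V → C) (n : V → ℕ) : Prop :=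
  ∃ ms, ValidMoves G L W f ms ∧ run f ms = g ∧ ∀ v, cnt ms v ≤ n v

/-- The neighbors of `v` in `W`. -/
noncomputable def nbrs (W : Finset V) (v : V) : Finset V := W.filter (G.Adj v)

variable {G L} {W : Finset V} {f g h : V → C} {n n' k : V → ℕ} {v : V} {c : C}

@[simp] lemma cnt_nil (v : V) : cnt ([] : List (V × C)) v = 0 := rfl

lemma cnt_cons (m : V × C) (ms : List (V × C)) (v : V) :
    cnt (m :: ms) v = cnt ms v + if v = m.1 then 1 else 0 := by
  simp only [cnt, List.countP_cons, decide_eq_true_eq, eq_comm (a := v)]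

lemma mem_nbrs {w : V} : w ∈ nbrs G W v ↔ w ∈ W ∧ G.Adj v w := by simp [nbrs]

lemma Reach.refl : Reach G L W f f n := ⟨[], trivial, rfl, fun v => by simp⟩

lemma Reach.mono (hr : Reach G L W f g n) (hn : ∀ w, n w ≤ n' w) : Reach G L W f g n' := by
  obtain ⟨ms, h1, h2, h3⟩ := hr
  exact ⟨ms, h1, h2, fun v => (h3 v).trans (hn v)⟩

lemma Reach.step (hm : CanMove G L W f v c) (hr : Reach G L W (Function.update f v c) g n)
    (hn : ∀ w, n w + (if w = v then 1 else 0) ≤ n' w) : Reach G L W f g n' := by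
  obtain ⟨ms, h1, h2, h3⟩ := hr
  refine ⟨(v, c) :: ms, ⟨hm, h1⟩, h2, fun w => ?_⟩
  rw [cnt_cons]
  exact (Nat.add_le_add_right (h3 w) _).trans (hn w)

lemma Reach.single (hm : CanMove G L W f v c) :
    Reach G L W f (Function.update f v c) (fun w => if w = v then 1 else 0) :=
  Reach.step (n := fun _ => 0) hm Reach.refl (by simp)

lemma Reach.trans (h1 : Reach G L W f g n) (h2 : Reach G L W g h k)
    (hn : ∀ w, n w + k w ≤ n' w) : Reach G L W f h n' := by
  obtain ⟨ms, hv, hr, hc⟩ := h1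
  induction ms generalizing f n n' with
  | nil =>
    cases hr
    exact h2.mono fun w => (Nat.le_add_left _ _).trans (hn w)
  | cons m ms ih =>
    refine Reach.step (n := fun w => cnt ms w + k w) hv.1
      (ih (n := cnt ms) (fun _ => le_rfl) hv.2 hr (fun _ => le_rfl)) fun w => ?_
    have := hc w
    have := hn w
    rw [cnt_cons] at *
    omega

lemma ProperOn.update (hf : ProperOn G L W f) (hm : CanMove G L W f v c) :
    ProperOn G L W (Function.update f v c) := by
  obtain ⟨hv, hc, hn⟩ := hm
  refine ⟨fun w hw => ?_, fun w hw z hz hwz => ?_⟩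
  · by_cases h : w = v
    · subst h; simpa using hc
    · simpa [h] using hf.mem w hw
  · by_cases h : w = v
    · subst h
      simpa [hwz.ne'] using (hn z hz hwz).symm
    · by_cases h' : z = v
      · subst h'
        simpa [h] using hn w hw hwz.symm
      · simpa [h, h'] using hf.ne w hw z hz hwz

lemma ValidMoves.congr {ms : List (V × C)} (hv : ValidMoves G L W f ms)
    (hfg : ∀ w ∈ W, f w = g w) : ValidMoves G L W g ms := by
  induction ms generalizing f g with
  | nil => trivial
  | cons m ms ih =>
    refine ⟨⟨hv.1.1, hv.1.2.1, fun w hw ha => hfg w hw ▸ hv.1.2.2 w hw ha⟩, ih hv.2 ?_⟩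
    intro w hw
    by_cases h : w = m.1
    · simp [h]
    · simp [h, hfg w hw]

lemma run_congr {ms : List (V × C)} (hfg : f v = g v) : run f ms v = run g ms v := by
  induction ms generalizing f g with
  | nil => exact hfg
  | cons m ms ih =>
    apply ih
    by_cases h : v = m.1
    · simp [h]
    · simp [h, hfg]

end Moves

/-! ### Choosing colors by looking ahead in a list of moves -/

section Lookahead

variable {V : Type*} {C : Type*} (G : SimpleGraph V)

/-- The number of moves of neighbors of `x`. -/
noncomputable def tot (x : V) (ms : List (V × C)) : ℕ := ms.countP (fun m => G.Adj x m.1)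

/-- The number of moves of neighbors of `x`, from the first one on that uses the color `c`. -/
noncomputable def load (x : V) (c : C) : List (V × C) → ℕ
  | [] => 0
  | m :: ms => if G.Adj x m.1 ∧ m.2 = c then tot G x (m :: ms) else load x c ms

variable {G} {L : V → Finset C} {W : Finset V} {f : V → C} {x : V} {c : C}

lemma tot_cons (x : V) (m : V × C) (ms : List (V × C)) :
    tot G x (m :: ms) = tot G x ms + if G.Adj x m.1 then 1 else 0 := by
  simp only [tot, List.countP_cons, decide_eq_true_eq]

lemma load_le_tot (x : V) (c : C) (ms : List (V × C)) : load G x c ms ≤ tot G x ms := by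
  induction ms with
  | nil => simp [load]
  | cons m ms ih =>
    rw [load]
    split_ifs
    · exact le_rfl
    · rw [tot_cons]; omega

/-- Pigeonhole: each of the first `k` moves of neighbors of `x` rules out at most one color of `A`,
so some color survives all of them. -/
lemma exists_load_le (x : V) (ms : List (V × C)) (A : Finset C) (k : ℕ) (hk : k + 1 ≤ A.card) :
    ∃ c ∈ A, load G x c ms ≤ tot G x ms - k := by
  induction ms generalizing A k with
  | nil =>
    obtain ⟨c, hc⟩ := Finset.card_pos.1 (by omega : 0 < A.card)
    exact ⟨c, hc, by simp [load]⟩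
  | cons m ms ih =>
    by_cases h : G.Adj x m.1
    · rcases k with _ | k
      · obtain ⟨c, hc⟩ := Finset.card_pos.1 (by omega : 0 < A.card)
        exact ⟨c, hc, load_le_tot _ _ _⟩
      · have := Finset.pred_card_le_card_erase (s := A) (a := m.2)
        obtain ⟨c, hc, hl⟩ := ih (A.erase m.2) k (by omega)
        rw [Finset.mem_erase] at hc
        refine ⟨c, hc.2, ?_⟩
        rw [load, if_neg (by tauto), tot_cons, if_pos h]
        omega
    · obtain ⟨c, hc, hl⟩ := ih A k hk
      refine ⟨c, hc, ?_⟩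
      rw [load, if_neg (by tauto), tot_cons, if_neg h]
      omega

/-- The source of all color choices below: `D` holds the colors forbidden now, and every color of
the list beyond the first one left over skips one future conflict. -/
lemma exists_color (hL : (L x).card = 6) (ms : List (V × C)) (D : Finset C) (k : ℕ)
    (hD : D.card + k + 1 ≤ 6) : ∃ c ∈ L x, c ∉ D ∧ load G x c ms ≤ tot G x ms - k := by
  have := Finset.le_card_sdiff D (L x)
  obtain ⟨c, hc, hl⟩ := exists_load_le (G := G) x ms (L x \ D) k (by omega)
  rw [Finset.mem_sdiff] at hc
  exact ⟨c, hc.1, hc.2, hl⟩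

lemma card_forbidden_le (f : V → C) (a : C) {s : Finset V} {d : ℕ} (hs : s.card ≤ d) :
    (insert a (s.image f)).card ≤ d + 1 :=
  (Finset.card_insert_le _ _).trans (Nat.succ_le_succ (Finset.card_image_le.trans hs))

lemma tot_eq_zero {ms : List (V × C)} (hv : ValidMoves G L W f ms)
    (hx : ∀ w ∈ W, ¬ G.Adj x w) : tot G x ms = 0 := by
  induction ms generalizing f with
  | nil => rfl
  | cons m ms ih => rw [tot_cons, ih hv.2, if_neg (hx _ hv.1.1)]

lemma tot_le {ms : List (V × C)} (hv : ValidMoves G L W f ms) :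
    tot G x ms ≤ ∑ w ∈ nbrs G W x, cnt ms w := by
  induction ms generalizing f with
  | nil => simp [tot]
  | cons m ms ih =>
    rw [tot_cons]
    simp_rw [cnt_cons]
    rw [Finset.sum_add_distrib]
    refine Nat.add_le_add (ih hv.2) ?_
    split_ifs with h
    · rw [Finset.sum_ite_eq' (nbrs G W x) m.1 (fun _ => 1), if_pos (mem_nbrs.2 ⟨hv.1.1, h⟩)]
    · exact Nat.zero_le _

end Lookahead

/-! ### Extending a sequence to deleted vertices -/

section Extension

variable {V : Type*} {C : Type*} {G : SimpleGraph V} {L : V → Finset C} {W X : Finset V}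
  {u : V} {f β : V → C}

/-- Extending a recoloring sequence to one more vertex of degree at most two. -/
lemma extend_low {x : V} (hx : x ∈ W) (hL : (L x).card = 6) (hd : (nbrs G W x).card ≤ 2)
    (ms : List (V × C)) (f : V → C) (hf : ProperOn G L W f)
    (hv : ValidMoves G L (W.erase x) f ms) :
    ∃ g, Reach G L W f g (fun w => if w = x then (load G x (f x) ms + 2) / 3 else cnt ms w) ∧
      ∀ w, w ≠ x → g w = run f ms w := by
  induction ms generalizing f with
  | nil => exact ⟨f, Reach.refl, fun w _ => rfl⟩
  | cons m ms ih =>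
    obtain ⟨⟨hmW, hmL, hmn⟩, hv'⟩ := hv
    obtain ⟨hmx, hmW⟩ := Finset.mem_erase.1 hmW
    -- Once `x` does not hold the color that `m` introduces next to it, `m` is legal in `W` and the
    -- induction hypothesis handles the rest.
    have key : ∀ f' : V → C, ProperOn G L W f' → (∀ w, w ≠ x → f' w = f w) →
        ¬ (G.Adj x m.1 ∧ m.2 = f' x) →
        ∃ g, Reach G L W f' g
          (fun w => if w = x then (load G x (f' x) ms + 2) / 3 else cnt (m :: ms) w) ∧
          ∀ w, w ≠ x → g w = run f (m :: ms) w := by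
      intro f' hf' hff hhit
      have hm : CanMove G L W f' m.1 m.2 := by
        refine ⟨hmW, hmL, fun w hw ha => ?_⟩
        by_cases h : w = x
        · subst h
          exact fun h => hhit ⟨ha.symm, h.symm⟩
        · rw [hff w h]
          exact hmn w (Finset.mem_erase.2 ⟨h, hw⟩) ha
      have hagree : ∀ w, w ≠ x → Function.update f m.1 m.2 w = Function.update f' m.1 m.2 w := by
        intro w hw
        by_cases h : w = m.1
        · simp [h]
        · simp [h, hff w hw]
      obtain ⟨g, hg, hgr⟩ := ih (Function.update f' m.1 m.2) (hf'.update hm)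
        (hv'.congr fun w hw => hagree w (Finset.mem_erase.1 hw).1)
      refine ⟨g, Reach.step hm hg fun w => ?_, fun w hw => ?_⟩
      · by_cases h : w = x
        · subst h
          simp [hmx.symm]
        · simp [h, cnt_cons]
      · rw [hgr w hw, run]
        exact (run_congr (hagree w hw)).symm
    by_cases hhit : G.Adj x m.1 ∧ m.2 = f x
    -- At most three colors are forbidden (that of `x` and of two neighbors), so two neighbor moves
    -- after `m` can be skipped; each move of `x` uses up three units of load.
    · obtain ⟨c, hcL, hcD, hl⟩ := exists_color (G := G) hL ms
        (insert (f x) ((nbrs G W x).image f)) 2 (by have := card_forbidden_le f (f x) hd; omega)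
      simp only [Finset.mem_insert, Finset.mem_image, not_or, not_exists, not_and] at hcD
      have hm : CanMove G L W f x c := ⟨hx, hcL, fun w hw ha => hcD.2 w (mem_nbrs.2 ⟨hw, ha⟩)⟩
      obtain ⟨g, hg, hgr⟩ := key (Function.update f x c) (hf.update hm)
        (fun w hw => by simp [hw]) (by simpa using fun _ h => hcD.1 (h.symm.trans hhit.2))
      refine ⟨g, Reach.step hm hg fun w => ?_, hgr⟩
      by_cases h : w = x
      · subst h
        have h1 : load G w (f w) (m :: ms) = tot G w (m :: ms) := by rw [load, if_pos hhit]
        have h2 := tot_cons (G := G) w m ms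
        rw [if_pos hhit.1] at h2
        simp only [Function.update_self, if_true]
        omega
      · simp [h]
    · obtain ⟨g, hg, hgr⟩ := key f hf (fun _ _ => rfl) hhit
      rw [load, if_neg hhit]
      exact ⟨g, hg, hgr⟩

/-- A bound for the number of moves of a vertex with load `R` that looks two events ahead, but three
events ahead at its first `j` moves. -/
def moveBound : ℕ → ℕ → ℕ
  | _, 0 => 0
  | 0, R + 1 => 1 + moveBound 0 (R - 1)
  | j + 1, R + 1 => 1 + moveBound j (R - 2)

lemma moveBound_mono (j : ℕ) {R R' : ℕ} (h : R ≤ R') : moveBound j R ≤ moveBound j R' := by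
  induction R' using Nat.strong_induction_on generalizing R j with
  | _ R' ih =>
    rcases R with _ | R
    · rw [moveBound]; exact Nat.zero_le _
    · rcases R' with _ | R'
      · omega
      · rcases j with _ | j <;> simp only [moveBound]
        · have := ih (R' - 1) (by omega) 0 (R := R - 1) (by omega)
          omega
        · have := ih (R' - 2) (by omega) j (R := R - 2) (by omega)
          omega

/-- A bound for the number of moves of a vertex that looks two events ahead. -/
def centerBound (l t : ℕ) : ℕ := if l = t then (t + 1) / 2 else t / 2

/-- The bound for the number of moves of `w` when `ms` is extended to `u` and `X`. -/
noncomputable def extBound (G : SimpleGraph V) (X : Finset V) (u : V) (j : V → ℕ) (f : V → C)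
    (ms : List (V × C)) (w : V) : ℕ :=
  if w ∈ X then moveBound (j w) (load G w (f w) ms)
  else if w = u then ∑ x ∈ X, j x + centerBound (load G u (f u) ms) (tot G u ms)
  else cnt ms w

/-- The vertex `u` can be moved away from its color. -/
lemma exists_displacement (hL : (L u).card = 6)
    (hdu : (nbrs G W u).card ≤ 3 ∨ ((nbrs G W u).card ≤ 4 ∧ nbrs G W u ⊆ X))
    {ms : List (V × C)} {f₀ : V → C} (hv : ValidMoves G L (W \ insert u X) f₀ ms) :
    ∃ c ∈ L u, c ≠ f u ∧ (∀ w ∈ W, G.Adj u w → f w ≠ c) ∧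
      load G u c ms ≤ tot G u ms - 1 := by
  suffices ∃ c ∈ L u, c ∉ insert (f u) ((nbrs G W u).image f) ∧
      load G u c ms ≤ tot G u ms - 1 by
    obtain ⟨c, h1, h2, h3⟩ := this
    simp only [Finset.mem_insert, Finset.mem_image, not_or, not_exists, not_and] at h2
    exact ⟨c, h1, h2.1, fun w hw ha => h2.2 w (mem_nbrs.2 ⟨hw, ha⟩), h3⟩
  rcases hdu with hd | ⟨hd, hs⟩
  · exact exists_color hL ms _ 1 (by have := card_forbidden_le f (f u) hd; omega)
  · obtain ⟨c, h1, h2, h3⟩ := exists_color (G := G) hL ms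
      (insert (f u) ((nbrs G W u).image f)) 0 (by have := card_forbidden_le f (f u) hd; omega)
    have := tot_eq_zero (x := u) hv (fun w hw ha => by
      simp only [Finset.mem_sdiff, Finset.mem_insert, not_or] at hw
      exact hw.2.2 (hs (mem_nbrs.2 ⟨hw.1, ha⟩)))
    exact ⟨c, h1, h2, by omega⟩

/-- A displacement can increase the load of `u`, so the bound must not depend on the load except
when the very next neighbor move conflicts. A displaced `u` is not in that position, and
displacement costs nothing in this term. -/
lemma centerBound_le {l l' t : ℕ} (h : l ≤ t - 1) : centerBound l t ≤ centerBound l' t := by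
  unfold centerBound
  split_ifs <;> omega

/-- Extending a recoloring sequence to `u` and some of its neighbors of degree at most three. -/
lemma extend_star (hu : u ∈ W) (hXW : X ⊆ W) (huX : ∀ x ∈ X, G.Adj u x)
    (hL : ∀ v, (L v).card = 6) (hdX : ∀ x ∈ X, (nbrs G W x).card ≤ 3)
    (hdu : (nbrs G W u).card ≤ 3 ∨ ((nbrs G W u).card ≤ 4 ∧ nbrs G W u ⊆ X))
    (ms : List (V × C)) (f : V → C) (j : V → ℕ) (hf : ProperOn G L W f)
    (hv : ValidMoves G L (W \ insert u X) f ms) :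
    ∃ g, Reach G L W f g (extBound G X u j f ms) ∧
      ∀ w, w ≠ u → w ∉ X → g w = run f ms w := by
  have huX' : u ∉ X := fun h => G.irrefl (huX u h)
  induction ms generalizing f j with
  | nil => exact ⟨f, Reach.refl, fun w _ _ => rfl⟩
  | cons m ms ih =>
    have hvv := hv
    obtain ⟨⟨hmW, hmL, hmn⟩, hv'⟩ := hvv
    simp only [Finset.mem_sdiff, Finset.mem_insert, not_or] at hmW
    obtain ⟨hmW, hmu, hmX⟩ := hmW
    -- It suffices to reach a coloring in which neither `u` nor a vertex of `X` blocks `m`.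
    have key : ∀ f' : V → C, ProperOn G L W f' → (∀ w, w ≠ u → w ∉ X → f' w = f w) →
        (∀ x ∈ insert u X, ¬ (G.Adj x m.1 ∧ m.2 = f' x)) → ∀ j : V → ℕ,
        ∃ g, Reach G L W f' g (fun w => extBound G X u j f' ms w + if w = m.1 then 1 else 0) ∧
          ∀ w, w ≠ u → w ∉ X → g w = run f (m :: ms) w := by
      intro f' hf' hff hhit j
      have hm : CanMove G L W f' m.1 m.2 := by
        refine ⟨hmW, hmL, fun w hw ha => ?_⟩
        by_cases h : w ∈ insert u X
        · exact fun h' => hhit w h ⟨ha.symm, h'.symm⟩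
        · have h' := h
          simp only [Finset.mem_insert, not_or] at h'
          rw [hff w h'.1 h'.2]
          exact hmn w (Finset.mem_sdiff.2 ⟨hw, h⟩) ha
      have hagree : ∀ w, w ≠ u → w ∉ X →
          Function.update f m.1 m.2 w = Function.update f' m.1 m.2 w := by
        intro w hw hw'
        by_cases h : w = m.1
        · simp [h]
        · simp [h, hff w hw hw']
      obtain ⟨g, hg, hgr⟩ := ih (Function.update f' m.1 m.2) j (hf'.update hm)
        (hv'.congr fun w hw => by
          simp only [Finset.mem_sdiff, Finset.mem_insert, not_or] at hw
          exact hagree w hw.2.1 hw.2.2)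
      refine ⟨g, Reach.step hm hg fun w => ?_, fun w hw hw' => ?_⟩
      · refine Nat.add_le_add_right ?_ _
        unfold extBound
        rw [Function.update_of_ne (Ne.symm hmu)]
        by_cases hwX : w ∈ X
        · rw [Function.update_of_ne (show w ≠ m.1 from fun h => hmX (h ▸ hwX))]
        · simp [hwX]
      · rw [hgr w hw hw', run]
        exact (run_congr (hagree w hw hw')).symm
    -- induction on the number of blocking vertices in `X`
    obtain ⟨N, hN⟩ : ∃ N, (X.filter fun x => G.Adj x m.1 ∧ m.2 = f x).card = N := ⟨_, rfl⟩
    induction N using Nat.strong_induction_on generalizing f j with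
    | _ N ihN =>
      by_cases hXhit : ∃ x ∈ X, G.Adj x m.1 ∧ m.2 = f x
      · obtain ⟨x, hxX, hxm, hmx⟩ := hXhit
        have hxu : x ≠ u := fun h => huX' (h ▸ hxX)
        have hload : load G x (f x) (m :: ms) = tot G x ms + 1 := by
          rw [load, if_pos ⟨hxm, hmx⟩, tot_cons, if_pos hxm]
        -- a move to `f'` that reduces the number of blocking vertices
        have fix : ∀ (f' : V → C) (j' : V → ℕ) (n : V → ℕ), ProperOn G L W f' →
            Reach G L W f f' n → (∀ w, w ≠ u → w ≠ x → f' w = f w) → f' x ≠ f x →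
            (∀ w, n w + extBound G X u j' f' (m :: ms) w ≤ extBound G X u j f (m :: ms) w) →
            ∃ g, Reach G L W f g (extBound G X u j f (m :: ms)) ∧
              ∀ w, w ≠ u → w ∉ X → g w = run f (m :: ms) w := by
          intro f' j' n hf' hr hff hfx hb
          have hagree : ∀ w, w ≠ u → w ∉ X → f' w = f w := fun w hw hwX =>
            hff w hw (fun h => hwX (h ▸ hxX))
          have hsub : (X.filter fun x => G.Adj x m.1 ∧ m.2 = f' x) ⊆
              (X.filter fun x => G.Adj x m.1 ∧ m.2 = f x).erase x := by
            intro y hy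
            simp only [Finset.mem_filter, Finset.mem_erase] at hy ⊢
            have hyx : y ≠ x := by
              rintro rfl
              exact hfx (hy.2.2.symm.trans hmx)
            refine ⟨hyx, hy.1, hy.2.1, ?_⟩
            rw [hy.2.2, hff y (fun h => huX' (h ▸ hy.1)) hyx]
          have hlt := (Finset.card_le_card hsub).trans_lt
            (Finset.card_erase_lt_of_mem (Finset.mem_filter.2 ⟨hxX, hxm, hmx⟩))
          rw [hN] at hlt
          have hvf' : ValidMoves G L (W \ insert u X) f' (m :: ms) := hv.congr fun w hw => by
            simp only [Finset.mem_sdiff, Finset.mem_insert, not_or] at hw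
            exact (hagree w hw.2.1 hw.2.2).symm
          have hrun : ∀ w, w ≠ u → w ∉ X → run f' (m :: ms) w = run f (m :: ms) w :=
            fun w hw hwX => run_congr (hagree w hw hwX)
          obtain ⟨g, hg, hgr⟩ := ihN _ hlt f' j' hf' hvf' hvf'.2 hvf'.1.2.2
            (by
              intro f'' hf'' hff'' hh j''
              obtain ⟨g, hg, hgr⟩ := key f'' hf''
                (fun w hw hwX => (hff'' w hw hwX).trans (hagree w hw hwX)) hh j''
              exact ⟨g, hg, fun w hw hwX => (hgr w hw hwX).trans (hrun w hw hwX).symm⟩) rfl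
          exact ⟨g, hr.trans hg hb, fun w hw hwX => (hgr w hw hwX).trans (hrun w hw hwX)⟩
        -- `j x` counts the conflicts at which `x` may still ignore `u`. When it is used up, `x`
        -- avoids all three neighbors and its own color; two colors remain and one further move is
        -- skipped.
        rcases Nat.eq_zero_or_pos (j x) with hj | hj
        · obtain ⟨c, hcL, hcD, hl⟩ := exists_color (G := G) (hL x) ms
            (insert (f x) ((nbrs G W x).image f)) 1
            (by have := card_forbidden_le f (f x) (hdX x hxX); omega)
          simp only [Finset.mem_insert, Finset.mem_image, not_or, not_exists, not_and] at hcD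
          have hm : CanMove G L W f x c :=
            ⟨hXW hxX, hcL, fun w hw ha => hcD.2 w (mem_nbrs.2 ⟨hw, ha⟩)⟩
          refine fix (Function.update f x c) j _ (hf.update hm) (Reach.single hm)
            (fun w _ hw => by simp [hw]) (by simpa using hcD.1) fun w => ?_
          unfold extBound
          by_cases hwx : w = x
          · subst hwx
            simp only [if_true, hxX, Function.update_self]
            have h2 : load G w c (m :: ms) ≤ tot G w ms - 1 := by
              rw [load, if_neg (by rintro ⟨-, h⟩; exact hcD.1 (h.symm.trans hmx))]
              exact hl
            rw [hload, hj, moveBound]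
            have := moveBound_mono 0 h2
            omega
          · simp [hwx, Ne.symm hxu]
        · obtain ⟨i, hi⟩ : ∃ i, j x = i + 1 := ⟨j x - 1, by omega⟩
          set j' : V → ℕ := Function.update j x i with hj'
          have hsum : ∑ y ∈ X, j' y + 1 = ∑ y ∈ X, j y := by
            rw [← Finset.add_sum_erase X j hxX, ← Finset.add_sum_erase X j' hxX]
            have : ∑ y ∈ X.erase x, j' y = ∑ y ∈ X.erase x, j y :=
              Finset.sum_congr rfl fun y hy => by
                simp [hj', (Finset.mem_erase.1 hy).1]
            rw [this]
            simp only [hj', Function.update_self, hi]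
            omega
          -- Without `u` only two neighbors restrict `x`, so three colors remain and two further
          -- moves are skipped.
          have hxu' : G.Adj x u := (huX x hxX).symm
          have hcard : ((nbrs G W x).erase u).card ≤ 2 := by
            rw [Finset.card_erase_of_mem (mem_nbrs.2 ⟨hu, hxu'⟩)]
            have := hdX x hxX
            omega
          obtain ⟨c, hcL, hcD, hl⟩ := exists_color (G := G) (hL x) ms
            (insert (f x) (((nbrs G W x).erase u).image f)) 2
            (by have := card_forbidden_le f (f x) hcard; omega)
          simp only [Finset.mem_insert, Finset.mem_image, not_or, not_exists, not_and,
            Finset.mem_erase] at hcD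
          have hcm : m.2 ≠ c := fun h => hcD.1 (h.symm.trans hmx)
          have hbx : 1 + moveBound i (load G x c (m :: ms)) ≤
              moveBound (j x) (load G x (f x) (m :: ms)) := by
            rw [hload, hi, moveBound, load, if_neg (by rintro ⟨-, h⟩; exact hcm h)]
            have := moveBound_mono i hl
            omega
          -- If `u` holds the chosen color, it is displaced first. The decrease of `∑ y ∈ X, j y` by
          -- one pays for this move.
          by_cases hcu : f u = c
          · obtain ⟨d, hdL, hdu', hdn, hdl⟩ := exists_displacement (f := f) (hL u) hdu hv
            have hmu' : CanMove G L W f u d := ⟨hu, hdL, hdn⟩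
            have hmx' : CanMove G L W (Function.update f u d) x c := by
              refine ⟨hXW hxX, hcL, fun w hw ha => ?_⟩
              by_cases hwu : w = u
              · subst hwu
                simpa [hcu] using hdu'
              · simpa [hwu] using hcD.2 w ⟨hwu, mem_nbrs.2 ⟨hw, ha⟩⟩
            refine fix (Function.update (Function.update f u d) x c) j'
              (fun w => (if w = u then 1 else 0) + if w = x then 1 else 0)
              ((hf.update hmu').update hmx')
              ((Reach.single hmu').trans (Reach.single hmx') fun w => le_rfl)
              (fun w h1 h2 => by simp [h1, h2]) (by simpa using hcD.1) fun w => ?_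
            unfold extBound
            by_cases hwx : w = x
            · subst hwx
              simpa [hxX, hxu, hj'] using hbx
            · by_cases hwu : w = u
              · subst hwu
                have := centerBound_le (l' := load G w (f w) (m :: ms)) hdl
                simp only [hwx, huX', if_true, if_false, Function.update_of_ne, ne_eq,
                  not_false_eq_true, Function.update_self]
                omega
              · by_cases hwX : w ∈ X
                · simp [hwx, hwu, hwX, hj']
                · simp [hwx, hwu, hwX]
          · have hmx' : CanMove G L W f x c := by
              refine ⟨hXW hxX, hcL, fun w hw ha => ?_⟩
              by_cases hwu : w = u
              · subst hwu
                exact hcu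
              · exact hcD.2 w ⟨hwu, mem_nbrs.2 ⟨hw, ha⟩⟩
            refine fix (Function.update f x c) j' _ (hf.update hmx') (Reach.single hmx')
              (fun w _ hw => by simp [hw]) (by simpa using hcD.1) fun w => ?_
            unfold extBound
            by_cases hwx : w = x
            · subst hwx
              simpa [hxX, hj'] using hbx
            · by_cases hwX : w ∈ X
              · simp [hwx, hwX, hj']
              · by_cases hwu : w = u
                · subst hwu
                  simp only [hwx, huX', if_true, if_false, Function.update_of_ne, ne_eq,
                    not_false_eq_true]
                  omega
                · simp [hwx, hwX, hwu]
      · push Not at hXhit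
        -- `u` is treated after `X`; its move avoids its own old color, which is that of `m`, and
        -- creates no new conflict of `X` with `m`.
        by_cases huhit : G.Adj u m.1 ∧ m.2 = f u
        · obtain ⟨c, hcL, hcu, hcn, hl⟩ := exists_displacement (f := f) (hL u) hdu hv'
          have hm : CanMove G L W f u c := ⟨hu, hcL, hcn⟩
          obtain ⟨g, hg, hgr⟩ := key (Function.update f u c) (hf.update hm)
            (fun w hw _ => by simp [hw]) (by
              intro y hy
              rw [Finset.mem_insert] at hy
              rcases hy with rfl | hy
              · rintro ⟨-, h⟩
                simp only [Function.update_self] at h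
                exact hcu (h.symm.trans huhit.2)
              · rintro ⟨h1, h2⟩
                rw [Function.update_of_ne (show y ≠ u from fun h => huX' (h ▸ hy))] at h2
                exact hXhit y hy h1 h2) j
          refine ⟨g, Reach.step hm hg fun w => ?_, hgr⟩
          unfold extBound
          by_cases hwX : w ∈ X
          · have hwu : w ≠ u := fun h => huX' (h ▸ hwX)
            have hwm : w ≠ m.1 := fun h => hmX (h ▸ hwX)
            simp only [hwX, hwu, hwm, if_true, if_false, Function.update_of_ne, ne_eq,
              not_false_eq_true, add_zero]
            rw [load, if_neg (fun h => hXhit w hwX h.1 h.2)]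
          · by_cases hwu : w = u
            · subst hwu
              have h1 : load G w (f w) (m :: ms) = tot G w (m :: ms) := by
                rw [load, if_pos huhit]
              have h2 := tot_cons (G := G) w m ms
              rw [if_pos huhit.1] at h2
              simp only [hwX, Ne.symm hmu, if_true, if_false, Function.update_self, add_zero]
              -- At a conflict load and total agree. With `t` neighbor moves left after `m`, the
              -- bound is `(t + 2) / 2 = 1 + t / 2`, and the lookahead of one brings the load
              -- strictly below `t` unless `t = 0`.
              rw [h1, h2]
              unfold centerBound
              split_ifs <;> omega
            · simp [hwX, hwu, cnt_cons]
        · obtain ⟨g, hg, hgr⟩ := key f hf (fun _ _ _ => rfl) (by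
              intro y hy
              rw [Finset.mem_insert] at hy
              rcases hy with rfl | hy
              · exact huhit
              · exact fun h => hXhit y hy h.1 h.2) j
          refine ⟨g, hg.mono fun w => ?_, hgr⟩
          unfold extBound
          by_cases hwX : w ∈ X
          · have hwm : w ≠ m.1 := fun h => hmX (h ▸ hwX)
            simp only [hwX, hwm, if_true, if_false, add_zero]
            rw [load, if_neg (fun h => hXhit w hwX h.1 h.2)]
          · by_cases hwu : w = u
            · subst hwu
              have h1 : load G w (f w) (m :: ms) = load G w (f w) ms := by
                rw [load, if_neg huhit]
              have h2 := tot_cons (G := G) w m ms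
              have h3 := load_le_tot (G := G) w (f w) ms
              simp only [hwX, Ne.symm hmu, if_true, if_false, add_zero]
              rw [h1, h2]
              unfold centerBound
              split_ifs <;> omega
            · simp [hwX, hwu, cnt_cons]

end Extension

/-! ### Moving the center and the leaves to their target colors -/

section Finish

variable {V : Type*} {C : Type*} {G : SimpleGraph V} {L : V → Finset C} {W X : Finset V}
  {u : V} {f β : V → C}

/-- The vertices of `Z` can be moved away from a color that they block at `y`. -/
lemma exists_unblock (hXW : X ⊆ W) (hL : ∀ v, (L v).card = 6)
    (hdX : ∀ x ∈ X, (nbrs G W x).card ≤ 3) (b : C) (Z : Finset V) (hZ : Z ⊆ X) :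
    ∃ g, Reach G L W f g (fun w => if w ∈ Z then 1 else 0) ∧ (∀ z ∈ Z, g z ≠ b) ∧
      ∀ w, g w = f w ∨ (w ∈ Z ∧ f w = b) := by
  induction Z using Finset.induction_on with
  | empty => exact ⟨f, Reach.refl, by simp, fun w => Or.inl rfl⟩
  | insert z Z hz ih =>
    obtain ⟨g, hr, hgb, hgf⟩ := ih ((Finset.subset_insert z Z).trans hZ)
    by_cases hgz : g z = b
    · have hzX := hZ (Finset.mem_insert_self z Z)
      obtain ⟨c, hcL, hcD, -⟩ := exists_color (G := G) (hL z) []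
        (insert (g z) ((nbrs G W z).image g)) 0
        (by have := card_forbidden_le g (g z) (hdX z hzX); omega)
      simp only [Finset.mem_insert, Finset.mem_image, not_or, not_exists, not_and] at hcD
      have hm : CanMove G L W g z c :=
        ⟨hXW hzX, hcL, fun w hw ha => hcD.2 w (mem_nbrs.2 ⟨hw, ha⟩)⟩
      refine ⟨Function.update g z c, hr.trans (Reach.single hm) fun w => ?_, ?_, fun w => ?_⟩
      · by_cases h : w = z
        · subst h; simp [hz]
        · simp [h]
      · intro w hw
        by_cases h : w = z
        · subst h
          simpa [← hgz] using hcD.1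
        · simpa [h] using hgb w (Finset.mem_of_mem_insert_of_ne hw h)
      · by_cases h : w = z
        · subst h
          right
          refine ⟨Finset.mem_insert_self _ _, ?_⟩
          rcases hgf w with h | h
          · rw [← h, hgz]
          · exact absurd h.1 hz
        · rw [Function.update_of_ne h]
          exact (hgf w).imp_right fun h => ⟨Finset.mem_insert_of_mem h.1, h.2⟩
    · refine ⟨g, hr.mono fun w => ?_, ?_, fun w => ?_⟩
      · by_cases h : w ∈ Z <;> simp [h]
      · intro w hw
        rw [Finset.mem_insert] at hw
        rcases hw with rfl | hw
        · exact hgz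
        · exact hgb w hw
      · exact (hgf w).imp_right fun h => ⟨Finset.mem_insert_of_mem h.1, h.2⟩

/-- The vertices of `Y` can be moved to their target colors if these are blocked by vertices of
`X` only. -/
lemma exists_settle (hXW : X ⊆ W) (hL : ∀ v, (L v).card = 6)
    (hdX : ∀ x ∈ X, (nbrs G W x).card ≤ 3) (hβ : ProperOn G L W β)
    (Y : Finset V) (hY : Y ⊆ X)
    (hfree : ∀ y ∈ Y, ∀ w ∈ W, w ∉ X → G.Adj y w → f w ≠ β y) :
    ∃ g, Reach G L W f g
        (fun w => if w ∈ X then (if w ∈ Y then 1 else 0) + (nbrs G Y w).card else 0) ∧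
      (∀ y ∈ Y, g y = β y) ∧ ∀ w, w ∉ Y → (w ∉ X ∨ f w = β w) → g w = f w := by
  induction Y using Finset.induction_on with
  | empty => exact ⟨f, Reach.refl, by simp, fun _ _ _ => rfl⟩
  | insert y Y hy ih =>
    obtain ⟨g, hr, hgβ, hgf⟩ := ih ((Finset.subset_insert y Y).trans hY)
      fun z hz => hfree z (Finset.mem_insert_of_mem hz)
    have hyX := hY (Finset.mem_insert_self y Y)
    have hYX := (Finset.subset_insert y Y).trans hY
    -- Only neighbors of `y` that hold `β y` are moved. Vertices already on target are not among
    -- them, because `β` is proper; so settled vertices stay settled.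
    obtain ⟨k, hk, hkb, hkg⟩ := exists_unblock hXW hL hdX (β y) (nbrs G X y)
      (Finset.filter_subset _ _) (f := g)
    have hm : CanMove G L W k y (β y) := by
      refine ⟨hXW hyX, hβ.mem y (hXW hyX), fun w hw ha => ?_⟩
      by_cases hwX : w ∈ X
      · exact hkb w (mem_nbrs.2 ⟨hwX, ha⟩)
      · rcases hkg w with h | h
        · rw [h, hgf w (fun h => hwX (hYX h)) (Or.inl hwX)]
          exact hfree y (Finset.mem_insert_self y Y) w hw hwX ha
        · exact absurd (mem_nbrs.1 h.1).1 hwX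
    refine ⟨Function.update k y (β y), (hr.trans hk fun w => le_rfl).trans (Reach.single hm)
      fun w => ?_, fun z hz => ?_, fun w hw hw' => ?_⟩
    · by_cases hwX : w ∈ X
      · have h1 : (nbrs G (insert y Y) w).card =
            (nbrs G Y w).card + if w ∈ nbrs G X y then 1 else 0 := by
          by_cases ha : G.Adj w y
          · rw [if_pos (mem_nbrs.2 ⟨hwX, ha.symm⟩), nbrs, Finset.filter_insert, if_pos ha,
              Finset.card_insert_of_notMem (by simp [hy])]
            rfl
          · rw [if_neg (fun h => ha (mem_nbrs.1 h).2.symm), nbrs, Finset.filter_insert, if_neg ha]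
            rfl
        have h2 : (if w ∈ Y then 1 else 0) + (if w = y then 1 else 0) =
            if w ∈ insert y Y then 1 else 0 := by
          by_cases h : w = y
          · subst h; simp [hy]
          · simp [h]
        simp only [hwX, if_true]
        omega
      · have h1 : w ≠ y := fun h => hwX (h ▸ hyX)
        simp [hwX, h1, mem_nbrs]
    · by_cases h : z = y
      · subst h; simp
      · have hzY := Finset.mem_of_mem_insert_of_ne hz h
        rw [Function.update_of_ne h]
        rcases hkg z with h' | h'
        · rw [h', hgβ z hzY]
        · have := hβ.ne y (hXW hyX) z (hXW (hYX hzY)) (mem_nbrs.1 h'.1).2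
          exact absurd ((hgβ z hzY).symm.trans h'.2).symm this
    · simp only [Finset.mem_insert, not_or] at hw
      rw [Function.update_of_ne hw.1]
      have h1 := hgf w hw.2 hw'
      rcases hkg w with h' | h'
      · rw [h', h1]
      · exfalso
        have hwX := (mem_nbrs.1 h'.1).1
        have h2 := hw'.resolve_left (not_not_intro hwX)
        exact hβ.ne y (hXW hyX) w (hXW hwX) (mem_nbrs.1 h'.1).2
          (h'.2.symm.trans (h1.trans h2))

/-- The last part of a recoloring sequence, when only `u` and `X` still have wrong colors. -/
lemma exists_finish (hu : u ∈ W) (hXW : X ⊆ W) (huX : u ∉ X)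
    (hL : ∀ v, (L v).card = 6) (hdX : ∀ x ∈ X, (nbrs G W x).card ≤ 3)
    (hdu : (nbrs G W u).card ≤ 4) (hβ : ProperOn G L W β)
    (hfβ : ∀ w ∈ W, w ≠ u → w ∉ X → f w = β w) :
    ∃ g, Reach G L W f g
        (fun w => if w ∈ X then 1 + (nbrs G X w).card else if w = u then 2 else 0) ∧
      ∀ w ∈ W, g w = β w := by
  -- The leaves in `A` are not obstructed by `u` and are settled first. Then `u` gives up its color,
  -- which is the target of all leaves in `B`, and after these `u` itself moves to its target.
  set A := X.filter fun x => β x ≠ f u with hA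
  set B := X.filter fun x => ¬ β x ≠ f u with hB
  have hAX : A ⊆ X := Finset.filter_subset _ _
  have hBX : B ⊆ X := Finset.filter_subset _ _
  have hout : ∀ y ∈ X, ∀ w ∈ W, w ≠ u → w ∉ X → G.Adj y w → f w ≠ β y := by
    intro y hy w hw hwu hwX ha
    rw [hfβ w hw hwu hwX]
    exact (hβ.ne y (hXW hy) w hw ha).symm
  obtain ⟨g₁, hr₁, hg₁, hgf₁⟩ := exists_settle (f := f) hXW hL hdX hβ A hAX (by
    intro y hy w hw hwX ha
    by_cases hwu : w = u
    · subst hwu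
      exact (Finset.mem_filter.1 hy).2.symm
    · exact hout y (hAX hy) w hw hwu hwX ha)
  have hg₁out : ∀ w, w ∉ X → g₁ w = f w := fun w hw =>
    hgf₁ w (fun h => hw (hAX h)) (Or.inl hw)
  -- At most four neighbors and the present color leave one of six colors.
  obtain ⟨c, hcL, hcD, -⟩ := exists_color (G := G) (hL u) []
    (insert (g₁ u) ((nbrs G W u).image g₁)) 0
    (by have := card_forbidden_le g₁ (g₁ u) hdu; omega)
  simp only [Finset.mem_insert, Finset.mem_image, not_or, not_exists, not_and] at hcD
  have hm₁ : CanMove G L W g₁ u c := ⟨hu, hcL, fun w hw ha => hcD.2 w (mem_nbrs.2 ⟨hw, ha⟩)⟩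
  obtain ⟨g₃, hr₃, hg₃, hgf₃⟩ := exists_settle (f := Function.update g₁ u c) hXW hL hdX hβ B hBX (by
    intro y hy w hw hwX ha
    by_cases hwu : w = u
    · subst hwu
      rw [Function.update_self, not_not.1 (Finset.mem_filter.1 hy).2, ← hg₁out w hwX]
      exact hcD.1
    · rw [Function.update_of_ne hwu, hg₁out w hwX]
      exact hout y (hBX hy) w hw hwu hwX ha)
  have hX : ∀ x ∈ X, g₃ x = β x := by
    intro x hx
    by_cases h : x ∈ B
    · exact hg₃ x h
    · have hxA : x ∈ A := by
        simp only [hA, hB, Finset.mem_filter, hx, true_and, not_not] at h ⊢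
        exact h
      have hxu : x ≠ u := fun h => huX (h ▸ hx)
      have h1 : Function.update g₁ u c x = β x := by
        rw [Function.update_of_ne hxu, hg₁ x hxA]
      rw [hgf₃ x h (Or.inr h1), h1]
  have hall : ∀ w ∈ W, w ≠ u → g₃ w = β w := by
    intro w hw hwu
    by_cases hwX : w ∈ X
    · exact hX w hwX
    · rw [hgf₃ w (fun h => hwX (hBX h)) (Or.inl hwX), Function.update_of_ne hwu, hg₁out w hwX,
        hfβ w hw hwu hwX]
  have hm₃ : CanMove G L W g₃ u (β u) := by
    refine ⟨hu, hβ.mem u hu, fun w hw ha => ?_⟩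
    rw [hall w hw ha.ne']
    exact (hβ.ne u hu w hw ha).symm
  refine ⟨Function.update g₃ u (β u),
    ((hr₁.trans (Reach.single hm₁) fun w => le_rfl).trans hr₃ fun w => le_rfl).trans
      (Reach.single hm₃) fun w => ?_, fun w hw => ?_⟩
  · by_cases hwX : w ∈ X
    · have hwu : w ≠ u := fun h => huX (h ▸ hwX)
      have h1 : (nbrs G A w).card + (nbrs G B w).card = (nbrs G X w).card := by
        rw [nbrs, nbrs, nbrs, hA, hB, Finset.filter_filter, Finset.filter_filter,
          ← Finset.card_filter_add_card_filter_not (s := X.filter (G.Adj w)) (fun x => β x ≠ f u),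
          Finset.filter_filter, Finset.filter_filter]
        simp only [and_comm]
      have h2 : (if w ∈ A then 1 else 0) + (if w ∈ B then 1 else 0) = 1 := by
        by_cases h : β w ≠ f u
        · simp [hA, hB, hwX, h]
        · simp only [hA, hB, Finset.mem_filter, hwX, true_and, h, if_false, not_false_eq_true,
            if_true]
      simp only [hwX, hwu, if_true, if_false]
      omega
    · by_cases hwu : w = u
      · subst hwu; simp [hwX]
      · simp [hwX, hwu]
  · by_cases hwu : w = u
    · subst hwu; simp
    · rw [Function.update_of_ne hwu]
      exact hall w hw hwu

end Finish

/-! ### Reducible configurations -/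

section Reducibility

variable {V : Type*} {C : Type*} {G : SimpleGraph V} {L : V → Finset C} {W X : Finset V}
  {u : V} {α β : V → C}

lemma ProperOn.subset {W' : Finset V} (h : ProperOn G L W α) (hW : W' ⊆ W) :
    ProperOn G L W' α :=
  ⟨fun v hv => h.mem v (hW hv), fun v hv w hw => h.ne v (hW hv) w (hW hw)⟩

variable (G L β) in
/-- The target coloring `β` of `G[W]` can be reached from everywhere with twelve moves per vertex. -/
def Reachable (W : Finset V) : Prop :=
  ∀ α : V → C, ProperOn G L W α →
    ∃ g, Reach G L W α g (fun _ => 12) ∧ ∀ w ∈ W, g w = β w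

lemma tot_le_mul {ms : List (V × C)} {f : V → C} (hv : ValidMoves G L W f ms) {k : ℕ} (x : V)
    (hc : ∀ v, cnt ms v ≤ k) : tot G x ms ≤ (nbrs G W x).card * k := by
  rw [← smul_eq_mul]
  exact (tot_le hv).trans (Finset.sum_le_card_nsmul _ _ _ fun w _ => hc w)

lemma reachable_of_low {x : V} (hx : x ∈ W) (hL : ∀ v, (L v).card = 6)
    (hd : (nbrs G W x).card ≤ 2) (hβ : ProperOn G L W β) (hW : Reachable G L β (W.erase x)) :
    Reachable G L β W := by
  intro α hα
  obtain ⟨g₀, ⟨ms, hv, hrun, hc⟩, hg₀⟩ := hW α (hα.subset (Finset.erase_subset _ _))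
  obtain ⟨g₁, hr₁, hg₁⟩ := extend_low hx (hL x) hd ms α hα hv
  have hg₁β : ∀ w ∈ W, w ≠ x → g₁ w = β w := fun w hw hwx => by
    rw [hg₁ w hwx, hrun, hg₀ w (Finset.mem_erase.2 ⟨hwx, hw⟩)]
  have hm : CanMove G L W g₁ x (β x) := by
    refine ⟨hx, hβ.mem x hx, fun w hw ha => ?_⟩
    rw [hg₁β w hw ha.ne']
    exact (hβ.ne x hx w hw ha).symm
  refine ⟨Function.update g₁ x (β x), hr₁.trans (Reach.single hm) fun w => ?_, fun w hw => ?_⟩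
  · by_cases hwx : w = x
    · subst hwx
      have h1 := tot_le_mul hv w hc
      have h2 := load_le_tot (G := G) w (α w) ms
      have h3 : (nbrs G (W.erase w) w).card ≤ 2 :=
        (Finset.card_le_card (Finset.filter_subset_filter _ (Finset.erase_subset _ _))).trans hd
      -- At most `24 / 3 = 8` moves and a final one.
      have h4 : tot G w ms ≤ 2 * 12 := h1.trans (Nat.mul_le_mul_right _ h3)
      simp only [if_true]
      omega
    · simpa [hwx] using hc w
  · by_cases hwx : w = x
    · subst hwx; simp
    · rw [Function.update_of_ne hwx, hg₁β w hw hwx]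

/-- Adds up the moves of `extend_star` and `exists_finish`. The second alternative for `u` makes all
its neighbors leaves, so that no replayed move touches its neighborhood. -/
lemma reachable_of_star (hu : u ∈ W) (hXW : X ⊆ W) (huX : ∀ x ∈ X, G.Adj u x)
    (hL : ∀ v, (L v).card = 6) (hdX : ∀ x ∈ X, (nbrs G W x).card ≤ 3)
    (hdu : ((nbrs G W u).card ≤ 3 ∧ X.card = 2) ∨ ((nbrs G W u).card ≤ 4 ∧ nbrs G W u ⊆ X))
    (hβ : ProperOn G L W β) (hW : Reachable G L β (W \ insert u X)) :
    Reachable G L β W := by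
  intro α hα
  have huX' : u ∉ X := fun h => G.irrefl (huX u h)
  obtain ⟨g₀, ⟨ms, hv, hrun, hc⟩, hg₀⟩ := hW α (hα.subset Finset.sdiff_subset)
  -- Two is the least budget that suffices for the leaves: `moveBound 0 24` and `moveBound 1 24`
  -- equal 12, `moveBound 2 24` equals 11, and a final move follows.
  obtain ⟨g₁, hr₁, hg₁⟩ := extend_star hu hXW huX hL hdX (hdu.imp_left And.left) ms α
    (fun _ => 2) hα hv
  obtain ⟨g₂, hr₂, hg₂⟩ := exists_finish hu hXW huX' hL hdX (by rcases hdu with h | h <;> omega)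
    hβ (f := g₁) (fun w hw hwu hwX => by
      rw [hg₁ w hwu hwX, hrun, hg₀ w (by simp [hw, hwu, hwX])])
  refine ⟨g₂, hr₁.trans hr₂ fun w => ?_, hg₂⟩
  unfold extBound
  by_cases hwX : w ∈ X
  · have hsplit : (nbrs G (W \ insert u X) w).card + (nbrs G X w).card + 1 ≤ 3 := by
      have hd : Disjoint (nbrs G (W \ insert u X) w) (nbrs G X w) := by
        rw [Finset.disjoint_left]
        intro y hy hy'
        have := (mem_nbrs.1 hy).1
        simp only [Finset.mem_sdiff, Finset.mem_insert, not_or] at this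
        exact this.2.2 (mem_nbrs.1 hy').1
      have hnot : u ∉ nbrs G (W \ insert u X) w ∪ nbrs G X w := by
        simp [mem_nbrs, huX']
      rw [← Finset.card_union_of_disjoint hd, ← Finset.card_insert_of_notMem hnot]
      refine (Finset.card_le_card ?_).trans (hdX w hwX)
      intro y hy
      simp only [Finset.mem_insert, Finset.mem_union, mem_nbrs, Finset.mem_sdiff] at hy
      rw [mem_nbrs]
      rcases hy with rfl | hy | hy
      · exact ⟨hu, (huX w hwX).symm⟩
      · exact ⟨hy.1.1, hy.2⟩
      · exact ⟨hXW hy.1, hy.2⟩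
    have h1 := (load_le_tot (G := G) w (α w) ms).trans (tot_le_mul hv w hc)
    simp only [hwX, if_true]
    obtain ⟨q, hq⟩ : ∃ q, (nbrs G X w).card = q := ⟨_, rfl⟩
    rw [hq] at hsplit ⊢
    have h2 : load G w (α w) ms ≤ (2 - q) * 12 := h1.trans (Nat.mul_le_mul_right _ (by omega))
    have h3 := moveBound_mono 2 h2
    have hq2 : q ≤ 2 := by omega
    -- The totals with the `1 + q` finishing moves are `11 + 1`, `5 + 2` and `0 + 3`.
    interval_cases q
    · have : moveBound 2 ((2 - 0) * 12) = 11 := by simp [moveBound]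
      omega
    · have : moveBound 2 ((2 - 1) * 12) = 5 := by simp [moveBound]
      omega
    · have : moveBound 2 ((2 - 2) * 12) = 0 := by simp [moveBound]
      omega
  · by_cases hwu : w = u
    · subst hwu
      have h0 : ∑ x ∈ X, 2 = X.card * 2 := by simp
      simp only [hwX, if_true, if_false]
      rw [h0]
      have hcb : centerBound (load G w (α w) ms) (tot G w ms) ≤ (tot G w ms + 1) / 2 := by
        unfold centerBound; split_ifs <;> omega
      have hXn : X ⊆ nbrs G W w := fun x hx => mem_nbrs.2 ⟨hXW hx, huX x hx⟩
      -- Displacements, own conflicts and finishing moves of the center: `4 + 6 + 2` when two leaves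
      -- leave one replayed neighbor, and at most `8 + 0 + 2` when all neighbors are leaves.
      rcases hdu with ⟨hd, hX2⟩ | ⟨hd, hs⟩
      · have h1 := tot_le_mul hv w hc
        have h2 : (nbrs G (W \ insert w X) w).card ≤ 1 := by
          have hsub : nbrs G (W \ insert w X) w ⊆ nbrs G W w \ X := by
            intro y hy
            simp only [mem_nbrs, Finset.mem_sdiff, Finset.mem_insert, not_or] at hy ⊢
            exact ⟨⟨hy.1.1, hy.2⟩, hy.1.2.2⟩
          have := Finset.card_le_card hsub
          rw [Finset.card_sdiff_of_subset hXn] at this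
          omega
        have h3 : tot G w ms ≤ 1 * 12 := h1.trans (Nat.mul_le_mul_right _ h2)
        omega
      · have h1 := tot_eq_zero (x := w) hv (fun y hy ha => by
          simp only [Finset.mem_sdiff, Finset.mem_insert, not_or] at hy
          exact hy.2.2 (hs (mem_nbrs.2 ⟨hy.1, ha⟩)))
        have := Finset.card_le_card hXn
        omega
    · simpa [hwX, hwu] using hc w

end Reducibility

/-! ### Unavoidable configurations by discharging -/

section Discharging

variable {V : Type*} {C : Type*} {G : SimpleGraph V} {L : V → Finset C} {W : Finset V}

/-- A graph with minimum degree at least three and average degree below `17/5` has a vertex of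
degree three with two neighbors of degree three, or a vertex of degree four all of whose neighbors
have degree three. -/
lemma exists_star (h3 : ∀ v ∈ W, 3 ≤ (nbrs G W v).card)
    (hs : 5 * ∑ v ∈ W, (nbrs G W v).card < 17 * W.card) :
    ∃ u ∈ W, ((nbrs G W u).card = 3 ∧
        2 ≤ ((nbrs G W u).filter fun x => (nbrs G W x).card = 3).card) ∨
      ((nbrs G W u).card = 4 ∧ ∀ x ∈ nbrs G W u, (nbrs G W x).card = 3) := by
  by_contra hcon
  push Not at hcon
  set d : V → ℕ := fun v => (nbrs G W v).card with hd
  set a : V → ℕ := fun v => ((nbrs G W v).filter fun x => d x = 3).card with ha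
  set b : V → ℕ := fun v => ((nbrs G W v).filter fun x => ¬ d x = 3).card with hb
  have hab : ∀ v, a v + b v = d v := fun v =>
    Finset.card_filter_add_card_filter_not _
  -- Each vertex `v` starts with charge `5 * d v`, and every vertex of degree other than 3 sends one
  -- unit to each 3-neighbor. What is sent equals what is received.
  have hsum : ∑ v ∈ W, (if d v = 3 then 0 else a v) = ∑ v ∈ W, if d v = 3 then b v else 0 := by
    have e1 : ∀ v ∈ W, (if d v = 3 then 0 else a v) =
        ∑ w ∈ W, if G.Adj v w ∧ d v ≠ 3 ∧ d w = 3 then 1 else 0 := by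
      intro v _
      split_ifs with h
      · simp [h]
      · simp only [ha, nbrs, Finset.filter_filter, Finset.card_filter]
        simp [h]
    have e2 : ∀ v ∈ W, (if d v = 3 then b v else 0) =
        ∑ w ∈ W, if G.Adj w v ∧ d w ≠ 3 ∧ d v = 3 then 1 else 0 := by
      intro v _
      split_ifs with h
      · simp only [hb, nbrs, Finset.filter_filter, Finset.card_filter]
        simp [h, G.adj_comm]
      · simp [h]
    rw [Finset.sum_congr rfl e1, Finset.sum_congr rfl e2, Finset.sum_comm]
  -- Every final charge is at least 17: a 3-vertex receives at least 2, a 4-vertex sends at most 3,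
  -- and a vertex of degree `d ≥ 5` keeps at least `4 * d ≥ 20`.
  have hpt : ∀ v ∈ W, 17 + (if d v = 3 then 0 else a v) ≤
      5 * d v + if d v = 3 then b v else 0 := by
    intro v hv
    obtain ⟨c1, c2⟩ := hcon v hv
    have h3v := h3 v hv
    have habv := hab v
    change 3 ≤ d v at h3v
    split_ifs with h
    · have : a v < 2 := c1 h
      omega
    · by_cases h4 : d v = 4
      · obtain ⟨x, hx, hx3⟩ := c2 h4
        have : 0 < b v := Finset.card_pos.2 ⟨x, Finset.mem_filter.2 ⟨hx, hx3⟩⟩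
        omega
      · omega
  have := Finset.sum_le_sum hpt
  rw [Finset.sum_add_distrib, Finset.sum_add_distrib, hsum, ← Finset.mul_sum, Finset.sum_const,
    smul_eq_mul] at this
  change 5 * ∑ v ∈ W, d v < _ at hs
  omega

variable (G) in
/-- All induced subgraphs of minimum degree at least three have average degree below `17/5`. -/
def IsSparse : Prop :=
  ∀ W : Finset V, W.Nonempty → (∀ v ∈ W, 3 ≤ (nbrs G W v).card) →
    5 * ∑ v ∈ W, (nbrs G W v).card < 17 * W.card

/-- Since sparsity is only needed when the minimum degree is at least three, the other induced
subgraphs are reduced by a vertex of low degree. -/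
lemma reachable_of_isSparse (hG : IsSparse G) (hL : ∀ v, (L v).card = 6) {β : V → C}
    (W : Finset V) (hβ : ProperOn G L W β) : Reachable G L β W := by
  induction W using Finset.strongInduction with
  | H W ih =>
    rcases W.eq_empty_or_nonempty with rfl | hne
    · exact fun α _ => ⟨α, Reach.refl, by simp⟩
    by_cases h3 : ∀ v ∈ W, 3 ≤ (nbrs G W v).card
    · obtain ⟨u, hu, h⟩ := exists_star h3 (hG W hne h3)
      have hlt : ∀ X : Finset V, W \ insert u X ⊂ W := fun X =>
        (Finset.ssubset_iff_of_subset Finset.sdiff_subset).2 ⟨u, hu, by simp⟩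
      have hstep := fun X : Finset V => ih _ (hlt X) (hβ.subset Finset.sdiff_subset)
      rcases h with ⟨hd, hc⟩ | ⟨hd, hx⟩
      · obtain ⟨X, hXs, hX2⟩ := Finset.exists_subset_card_eq hc
        have hX : ∀ x ∈ X, (x ∈ W ∧ G.Adj u x) ∧ (nbrs G W x).card = 3 := fun x hx => by
          have := Finset.mem_filter.1 (hXs hx)
          exact ⟨mem_nbrs.1 this.1, this.2⟩
        exact reachable_of_star hu (fun x hx => (hX x hx).1.1) (fun x hx => (hX x hx).1.2) hL
          (fun x hx => (hX x hx).2.le) (Or.inl ⟨hd.le, hX2⟩) hβ (hstep X)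
      · exact reachable_of_star hu (X := nbrs G W u) (fun x hx => (mem_nbrs.1 hx).1)
          (fun x hx => (mem_nbrs.1 hx).2) hL (fun x h => (hx x h).le)
          (Or.inr ⟨hd.le, Finset.Subset.refl _⟩) hβ (hstep _)
    · push Not at h3
      obtain ⟨x, hx, hd⟩ := h3
      exact reachable_of_low hx hL (by omega) hβ
        (ih _ (Finset.erase_ssubset hx) (hβ.subset (Finset.erase_subset _ _)))

end Discharging

/-! ### From lists of moves to walks in the recoloring graph -/

section Walks

variable {V : Type*} {C : Type*} {G : SimpleGraph V} {L : V → Finset C}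

lemma exists_walk_of_validMoves [Fintype V] (ms : List (V × C)) (α β : LColoring G L)
    (hv : ValidMoves G L Finset.univ (fun v => α.1 v) ms)
    (hr : run (fun v => α.1 v) ms = fun v => β.1 v) :
    ∃ σ : RecoloringSequence G L α β, ∀ v, timesRecolored σ v ≤ cnt ms v := by
  induction ms generalizing α with
  | nil =>
    have : α = β := Subtype.ext (DFunLike.ext _ _ fun v => congrFun hr v)
    subst this
    exact ⟨SimpleGraph.Walk.nil, fun v => by simp [timesRecolored]⟩
  | cons m ms ih =>
    have hp : ProperOn G L Finset.univ (fun v => α.1 v) :=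
      ⟨fun v _ => α.2 v, fun v _ w _ h => α.1.valid h⟩
    have hp' := hp.update hv.1
    let γ : LColoring G L :=
      ⟨SimpleGraph.Coloring.mk (Function.update (fun v => α.1 v) m.1 m.2)
        (fun {v w} h => hp'.ne v (Finset.mem_univ _) w (Finset.mem_univ _) h),
        fun v => hp'.mem v (Finset.mem_univ _)⟩
    have hγ : (fun v => γ.1 v) = Function.update (fun v => α.1 v) m.1 m.2 := rfl
    obtain ⟨σ, hσ⟩ := ih γ (by rw [hγ]; exact hv.2) (by rw [hγ]; exact hr)
    -- A legal move may keep the color; such a move is not an edge of the recoloring graph and is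
    -- dropped.
    by_cases hm : α.1 m.1 = m.2
    · have : α = γ := Subtype.ext (DFunLike.ext _ _ fun v => by
        change _ = Function.update (fun v => α.1 v) m.1 m.2 v
        rw [← hm, Function.update_eq_self])
      rw [this]
      exact ⟨σ, fun v => (hσ v).trans (by rw [cnt_cons]; omega)⟩
    · have hadj : (recoloringGraph G L).Adj α γ := by
        refine ⟨m.1, ?_, fun v hv => ?_⟩
        · change α.1 m.1 ≠ Function.update (fun v => α.1 v) m.1 m.2 m.1
          rwa [Function.update_self]
        · by_contra hne
          refine hv ?_
          change α.1 v = Function.update (fun v => α.1 v) m.1 m.2 v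
          rw [Function.update_of_ne hne]
      refine ⟨SimpleGraph.Walk.cons hadj σ, fun v => ?_⟩
      have := hσ v
      unfold timesRecolored at this ⊢
      rw [SimpleGraph.Walk.darts_cons, List.countP_cons, cnt_cons]
      refine Nat.add_le_add this ?_
      by_cases hvm : v = m.1
      · simp only [hvm, if_true]
        split_ifs <;> simp
      · have : γ.1 v = α.1 v := by
          change Function.update (fun v => α.1 v) m.1 m.2 v = _
          rw [Function.update_of_ne hvm]
        simp [hvm, this]

theorem exists_isGood_of_isSparse [Finite V] (hG : IsSparse G) (hL : IsKAssignment 6 L)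
    (α β : LColoring G L) : ∃ σ : RecoloringSequence G L α β, IsGood 12 σ := by
  have := Fintype.ofFinite V
  have hp : ∀ γ : LColoring G L, ProperOn G L Finset.univ (fun v => γ.1 v) := fun γ =>
    ⟨fun v _ => γ.2 v, fun v _ w _ h => γ.1.valid h⟩
  obtain ⟨g, ⟨ms, hv, hr, hc⟩, hg⟩ :=
    reachable_of_isSparse hG hL Finset.univ (hp β) _ (hp α)
  obtain ⟨σ, hσ⟩ := exists_walk_of_validMoves ms α β hv
    (by rw [hr]; exact funext fun v => hg v (Finset.mem_univ v))
  exact ⟨σ, fun v => (hσ v).trans (hc v)⟩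

end Walks

/-! ### Sparsity from the maximum average degree -/

section Mad

variable {V : Type*} {G : SimpleGraph V}

lemma isSparse_of_mad_lt [Finite V] (h : mad G < 17 / 5) : IsSparse G := by
  have := Fintype.ofFinite V
  intro W hW _
  let H : G.Subgraph := (⊤ : G.Subgraph).induce (W : Set V)
  have hle : 2 * (H.edgeSet.ncard : ℝ) / (H.verts.ncard : ℝ) ≤ mad G :=
    le_ciSup (f := fun H : {H : G.Subgraph // H.verts.Nonempty} =>
      2 * (H.1.edgeSet.ncard : ℝ) / (H.1.verts.ncard : ℝ)) (Set.finite_range _).bddAbove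
      ⟨H, by simpa [H] using hW⟩
  have hverts : H.verts.ncard = W.card := by simp [H, Set.ncard_coe_finset]
  have hdeg : ∑ v ∈ W, (nbrs G W v).card = 2 * H.edgeSet.ncard := by
    have h1 := H.spanningCoe.sum_degrees_eq_twice_card_edges
    have h2 : H.spanningCoe.edgeFinset.card = H.edgeSet.ncard := by
      rw [← Set.ncard_coe_finset, SimpleGraph.coe_edgeFinset, SimpleGraph.Subgraph.edgeSet_spanningCoe]
    rw [h2] at h1
    rw [← h1, ← Finset.sum_subset (Finset.subset_univ W)]
    · refine Finset.sum_congr rfl fun v hv => ?_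
      rw [← SimpleGraph.card_neighborFinset_eq_degree]
      congr 1
      ext w
      simp [mem_nbrs, H, hv]
    · intro v _ hv
      rw [← SimpleGraph.card_neighborFinset_eq_degree, Finset.card_eq_zero]
      ext w
      simp [H, hv]
  rw [hverts] at hle
  have hpos : (0 : ℝ) < W.card := by exact_mod_cast Finset.card_pos.2 hW
  have := hle.trans_lt h
  rw [div_lt_iff₀ hpos] at this
  rw [hdeg]
  have h5 : (5 * (2 * H.edgeSet.ncard) : ℝ) < 17 * W.card := by linarith
  exact_mod_cast h5

end Mad

/-! ### Faces of straight-line plane graphs -/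

section PlaneGraph

/-- A finite graph whose vertices are points of the plane and whose edges, drawn as line segments,
meet only in common ends. -/
structure IsPlaneGraph (H : SimpleGraph ℂ) : Prop where
  finite : {d : ℂ × ℂ | H.Adj d.1 d.2}.Finite
  cross : ∀ a b c d, H.Adj a b → H.Adj c d → ∀ x ∈ segment ℝ a b, x ∈ segment ℝ c d →
    s(a, b) = s(c, d) ∨ ((x = a ∨ x = b) ∧ (x = c ∨ x = d))

/-- The union of the edges of a graph whose vertices are points of the plane. -/
def drawing (H : SimpleGraph ℂ) : Set ℂ := {z | ∃ d : ℂ × ℂ, H.Adj d.1 d.2 ∧ z ∈ segment ℝ d.1 d.2}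

/-- A point that lies on the right of the segment from `a` to `b` when `0 < η`. -/
noncomputable def sidePt (a b : ℂ) (t η : ℝ) : ℂ := a + (b - a) * (t - η * Complex.I)

lemma continuous_sidePt (a b : ℂ) : Continuous fun p : ℝ × ℝ => sidePt a b p.1 p.2 := by
  unfold sidePt; fun_prop

/-- The component of the complement of the drawing on the right of the segment from `a` to `b`. -/
noncomputable def face (H : SimpleGraph ℂ) (a b : ℂ) : Set ℂ :=
  Classical.epsilon fun F => ∀ t ∈ Set.Ioo (0 : ℝ) 1, ∀ᶠ η : ℝ in 𝓝[>] (0 : ℝ),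
    sidePt a b t η ∈ (drawing H)ᶜ ∧ connectedComponentIn (drawing H)ᶜ (sidePt a b t η) = F

lemma connectedComponentIn_eq_of_isPreconnected {K A : Set ℂ} (hA : IsPreconnected A)
    (hAK : A ⊆ K) {x y : ℂ} (hx : x ∈ A) (hy : y ∈ A) :
    connectedComponentIn K x = connectedComponentIn K y :=
  connectedComponentIn_eq (hA.subset_connectedComponentIn hx hAK hy)

variable {H : SimpleGraph ℂ} {a b : ℂ}

lemma mem_segment_iff_exists {a b z : ℂ} :
    z ∈ segment ℝ a b ↔ ∃ s : ℝ, 0 ≤ s ∧ s ≤ 1 ∧ z = a + (b - a) * s := by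
  rw [segment_eq_image']
  simp only [Set.mem_image, Set.mem_Icc, Complex.real_smul]
  constructor
  · rintro ⟨s, hs, rfl⟩
    exact ⟨s, hs.1, hs.2, by ring⟩
  · rintro ⟨s, h0, h1, rfl⟩
    exact ⟨s, ⟨h0, h1⟩, by ring⟩

lemma IsPlaneGraph.isClosed (hH : IsPlaneGraph H) (P : ℂ × ℂ → Prop) :
    IsClosed {z | ∃ d : ℂ × ℂ, H.Adj d.1 d.2 ∧ P d ∧ z ∈ segment ℝ d.1 d.2} := by
  have : {z | ∃ d : ℂ × ℂ, H.Adj d.1 d.2 ∧ P d ∧ z ∈ segment ℝ d.1 d.2} =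
      ⋃ d ∈ {d : ℂ × ℂ | H.Adj d.1 d.2 ∧ P d}, segment ℝ d.1 d.2 := by
    ext z; simp [and_assoc]
  rw [this]
  refine Set.Finite.isClosed_biUnion (hH.finite.subset fun d hd => hd.1) fun d _ => ?_
  rw [segment_eq_image']
  exact (isCompact_Icc.image (by fun_prop)).isClosed

lemma sidePt_notMem_segment (hab : a ≠ b) {t η : ℝ} (hη : η ≠ 0) :
    sidePt a b t η ∉ segment ℝ a b := by
  rw [mem_segment_iff_exists]
  rintro ⟨s, -, -, h⟩
  have h1 : (t - η * Complex.I : ℂ) = s :=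
    mul_left_cancel₀ (sub_ne_zero.2 hab.symm) (add_left_cancel h)
  have := congrArg Complex.im h1
  simp at this
  exact hη this

lemma sidePt_zero_ne (hab : a ≠ b) {t : ℝ} (h0 : 0 < t) (h1 : t < 1) :
    sidePt a b t 0 ≠ a ∧ sidePt a b t 0 ≠ b := by
  have hne : b - a ≠ 0 := sub_ne_zero.2 hab.symm
  constructor
  · intro h
    have : (b - a) * (t : ℂ) = 0 := by
      simpa [sidePt] using h
    rcases mul_eq_zero.1 this with h' | h'
    · exact hne h'
    · exact h0.ne' (by exact_mod_cast h')
  · intro h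
    have : (b - a) * ((t : ℂ) - 1) = 0 := by
      simp only [sidePt, Complex.ofReal_zero, zero_mul, sub_zero] at h
      linear_combination h
    rcases mul_eq_zero.1 this with h' | h'
    · exact hne h'
    · have h2 : (t : ℂ) = 1 := sub_eq_zero.1 h'
      exact h1.ne (by exact_mod_cast h2)

lemma sidePt_zero_mem {t : ℝ} (h0 : 0 < t) (h1 : t < 1) : sidePt a b t 0 ∈ segment ℝ a b :=
  mem_segment_iff_exists.2 ⟨t, h0.le, h1.le, by simp [sidePt]⟩

/-- Near the interior of an edge, the drawing consists of this edge only. -/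
lemma IsPlaneGraph.exists_strip (hH : IsPlaneGraph H) (hab : H.Adj a b) {t₀ t₁ : ℝ} (h0 : 0 < t₀)
    (h1 : t₁ < 1) : ∃ η₀ > 0, ∀ t ∈ Set.Icc t₀ t₁, ∀ η ∈ Set.Ioo 0 η₀,
      sidePt a b t η ∈ (drawing H)ᶜ := by
  -- The other edges form a closed set missing the compact part `[t₀, t₁]` of the edge, so the tube
  -- lemma gives a uniform width. Points with `η ≠ 0` are off the edge itself.
  have hO := ((hH.isClosed fun d => s(a, b) ≠ s(d.1, d.2)).isOpen_compl).preimage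
    (continuous_sidePt a b)
  obtain ⟨u, v, -, hv, hsu, htv, huv⟩ := generalized_tube_lemma (isCompact_Icc (a := t₀) (b := t₁))
    (isCompact_singleton (x := (0 : ℝ))) hO (by
      rintro ⟨t, η⟩ ⟨ht, rfl⟩
      simp only [Set.mem_Icc] at ht
      rintro ⟨d, hd, hne, hz⟩
      have h0' := h0.trans_le ht.1
      have h1' := ht.2.trans_lt h1
      have hn := sidePt_zero_ne hab.ne h0' h1'
      rcases hH.cross a b d.1 d.2 hab hd _ (sidePt_zero_mem h0' h1') hz with h | h
      · exact hne h
      · rcases h.1 with h | h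
        · exact hn.1 h
        · exact hn.2 h)
  obtain ⟨ε, hε, hball⟩ := Metric.isOpen_iff.1 hv 0 (htv rfl)
  refine ⟨ε, hε, fun t ht η hη => ?_⟩
  have hmem : (t, η) ∈ u ×ˢ v := ⟨hsu ht, hball (by
    simpa [Real.dist_eq, abs_of_pos hη.1] using hη.2)⟩
  rintro ⟨d, hd, hz⟩
  refine huv hmem ⟨d, hd, fun hne => ?_, hz⟩
  refine sidePt_notMem_segment (t := t) hab.ne hη.1.ne' ?_
  rcases Sym2.eq_iff.1 hne with ⟨h, h'⟩ | ⟨h, h'⟩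
  · rw [h, h']
    simpa only [← h, ← h'] using hz
  · rw [h, h', segment_symm]
    simpa only [← h, ← h'] using hz

/-- Strips on the right of the edge are connected and avoid the drawing, so all points close to the
edge on this side lie in the component found near its midpoint. -/
lemma IsPlaneGraph.face_spec (hH : IsPlaneGraph H) (hab : H.Adj a b) :
    ∀ t ∈ Set.Ioo (0 : ℝ) 1, ∀ᶠ η : ℝ in 𝓝[>] (0 : ℝ), sidePt a b t η ∈ (drawing H)ᶜ ∧
      connectedComponentIn (drawing H)ᶜ (sidePt a b t η) = face H a b := by
  apply Classical.epsilon_spec (p := fun F : Set ℂ => ∀ t ∈ Set.Ioo (0 : ℝ) 1,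
    ∀ᶠ η : ℝ in 𝓝[>] (0 : ℝ), sidePt a b t η ∈ (drawing H)ᶜ ∧
      connectedComponentIn (drawing H)ᶜ (sidePt a b t η) = F)
  have hstrip : ∀ t₀ t₁ : ℝ, 0 < t₀ → t₁ < 1 → ∃ η₀ > 0, ∀ t ∈ Set.Icc t₀ t₁, ∀ η ∈ Set.Ioo 0 η₀,
      ∀ t' ∈ Set.Icc t₀ t₁, ∀ η' ∈ Set.Ioo 0 η₀, sidePt a b t η ∈ (drawing H)ᶜ ∧
      connectedComponentIn (drawing H)ᶜ (sidePt a b t η) =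
        connectedComponentIn (drawing H)ᶜ (sidePt a b t' η') := by
    intro t₀ t₁ h0 h1
    obtain ⟨η₀, hη₀, h⟩ := hH.exists_strip hab h0 h1
    refine ⟨η₀, hη₀, fun t ht η hη t' ht' η' hη' => ⟨h t ht η hη, ?_⟩⟩
    refine connectedComponentIn_eq_of_isPreconnected
      (A := (fun p : ℝ × ℝ => sidePt a b p.1 p.2) '' (Set.Icc t₀ t₁ ×ˢ Set.Ioo 0 η₀))
      ((isPreconnected_Icc.prod isPreconnected_Ioo).image _ (continuous_sidePt a b).continuousOn)
      ?_ ⟨(t, η), ⟨ht, hη⟩, rfl⟩ ⟨(t', η'), ⟨ht', hη'⟩, rfl⟩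
    rintro _ ⟨⟨t, η⟩, ⟨ht, hη⟩, rfl⟩
    exact h t ht η hη
  obtain ⟨η₁, hη₁, hs₁⟩ := hstrip (1 / 2) (1 / 2) (by norm_num) (by norm_num)
  refine ⟨connectedComponentIn (drawing H)ᶜ (sidePt a b (1 / 2) (η₁ / 2)), fun t ht => ?_⟩
  obtain ⟨η₂, hη₂, hs₂⟩ := hstrip (min t (1 / 2)) (max t (1 / 2))
    (lt_min ht.1 (by norm_num)) (max_lt ht.2 (by norm_num))
  filter_upwards [Ioo_mem_nhdsGT (lt_min hη₁ hη₂)] with η hη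
  have e2 := hs₂ t ⟨min_le_left _ _, le_max_left _ _⟩ η ⟨hη.1, hη.2.trans_le (min_le_right _ _)⟩
    (1 / 2) ⟨min_le_right _ _, le_max_right _ _⟩ η ⟨hη.1, hη.2.trans_le (min_le_right _ _)⟩
  have e1 := hs₁ (1 / 2) ⟨le_rfl, le_rfl⟩ η ⟨hη.1, hη.2.trans_le (min_le_left _ _)⟩
    (1 / 2) ⟨le_rfl, le_rfl⟩ (η₁ / 2) ⟨by linarith, by linarith⟩
  exact ⟨e2.1, e2.2.trans e1.2⟩

/-- The argument of a complex number, taken in `(0, 2π]`. -/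
noncomputable def posArg (w : ℂ) : ℝ := Complex.arg (-w) + Real.pi

lemma posArg_pos (w : ℂ) : 0 < posArg w := by
  have := Complex.neg_pi_lt_arg (-w)
  unfold posArg; linarith

lemma posArg_le (w : ℂ) : posArg w ≤ 2 * Real.pi := by
  have := Complex.arg_le_pi (-w)
  unfold posArg; linarith

lemma exp_sub_pi (θ : ℝ) :
    Complex.exp ((θ - Real.pi : ℝ) * Complex.I) = - Complex.exp (θ * Complex.I) := by
  rw [Complex.ofReal_sub, sub_mul, Complex.exp_sub, Complex.exp_pi_mul_I, div_neg, div_one]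

lemma posArg_polar {r θ : ℝ} (hr : 0 < r) (h0 : 0 < θ) (h1 : θ ≤ 2 * Real.pi) :
    posArg (r * Complex.exp (θ * Complex.I)) = θ := by
  unfold posArg
  rw [← mul_neg, ← exp_sub_pi, Complex.arg_real_mul _ hr, Complex.exp_mul_I,
    Complex.arg_cos_add_sin_mul_I ⟨by linarith, by linarith⟩]
  ring

lemma norm_mul_exp_posArg (w : ℂ) : ‖w‖ * Complex.exp (posArg w * Complex.I) = w := by
  have h := Complex.norm_mul_exp_arg_mul_I (-w)
  have h2 : Complex.arg (-w) = posArg w - Real.pi := by unfold posArg; ring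
  rw [h2, exp_sub_pi, norm_neg, mul_neg, neg_inj] at h
  exact h

lemma posArg_one : posArg 1 = 2 * Real.pi := by
  unfold posArg; rw [Complex.arg_neg_one]; ring

lemma eq_of_posArg_eq {w : ℂ} (hw : posArg w = 2 * Real.pi) : w = ‖w‖ := by
  conv_lhs => rw [← norm_mul_exp_posArg w, hw]
  push_cast
  rw [Complex.exp_two_pi_mul_I, mul_one]

/-- Two edges at `b` have different directions. -/
lemma IsPlaneGraph.posArg_lt (hH : IsPlaneGraph H) (hab : H.Adj a b) {c : ℂ} (hbc : H.Adj b c)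
    (hca : c ≠ a) : posArg ((c - b) / (a - b)) < 2 * Real.pi := by
  refine lt_of_le_of_ne (posArg_le _) fun h => ?_
  have hq := eq_of_posArg_eq h
  set q := ‖(c - b) / (a - b)‖ with hqdef
  have hr : a - b ≠ 0 := sub_ne_zero.2 hab.ne
  have hcb : c - b ≠ 0 := sub_ne_zero.2 hbc.ne.symm
  have hqpos : 0 < q := norm_pos_iff.2 (div_ne_zero hcb hr)
  rw [div_eq_iff hr] at hq
  have hs : s(a, b) ≠ s(b, c) := by
    intro h
    rcases Sym2.eq_iff.1 h with ⟨h1, -⟩ | ⟨h1, -⟩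
    · exact hab.ne h1
    · exact hca h1.symm
  rcases le_total q 1 with hq1 | hq1
  · rcases hH.cross a b b c hab hbc c
      (by rw [segment_symm]; exact mem_segment_iff_exists.2 ⟨q, hqpos.le, hq1, by
        linear_combination hq⟩)
      (right_mem_segment ℝ b c) with h | h
    · exact hs h
    · rcases h.1 with h | h
      · exact hca h
      · exact hbc.ne h.symm
  · rcases hH.cross a b b c hab hbc a (left_mem_segment ℝ a b)
      (mem_segment_iff_exists.2 ⟨q⁻¹, (inv_pos.2 hqpos).le, inv_le_one_of_one_le₀ hq1, by
        have : (q : ℂ) ≠ 0 := by exact_mod_cast hqpos.ne'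
        rw [hq]; push_cast; field_simp; ring⟩) with h | h
    · exact hs h
    · rcases h.2 with h | h
      · exact hab.ne h
      · exact hca h.symm

/-- Translates points beside an edge into polar coordinates around its end. The two signs of `η`
serve the two edges that bound a sector. -/
lemma exists_polar_of_near {P Q : ℝ} (hQ : 0 < Q) {t : ℝ} (ht : 0 < t) (htP : t < P) :
    ∀ᶠ η : ℝ in 𝓝[>] (0 : ℝ), ∃ ρ θ : ℝ, 0 < ρ ∧ ρ < P ∧ 0 < θ ∧ θ < Q ∧
      (t + η * Complex.I : ℂ) = ρ * Complex.exp (θ * Complex.I) ∧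
      (t - η * Complex.I : ℂ) = ρ * Complex.exp ((-θ : ℝ) * Complex.I) := by
  have hc : Filter.Tendsto (fun η : ℝ => (t + η * Complex.I : ℂ)) (𝓝 0) (𝓝 (t : ℂ)) := by
    have : Continuous fun η : ℝ => (t + η * Complex.I : ℂ) := by fun_prop
    simpa using this.tendsto 0
  have hts : (t : ℂ) ∈ Complex.slitPlane := by
    simp [Complex.mem_slitPlane_iff, ht]
  have harg : ∀ᶠ η : ℝ in 𝓝 (0 : ℝ), Complex.arg (t + η * Complex.I : ℂ) < Q := by
    refine ((Complex.continuousAt_arg hts).tendsto.comp hc).eventually (gt_mem_nhds ?_)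
    rwa [Complex.arg_ofReal_of_nonneg ht.le]
  have hnorm : ∀ᶠ η : ℝ in 𝓝 (0 : ℝ), ‖(t + η * Complex.I : ℂ)‖ < P := by
    refine hc.norm.eventually (gt_mem_nhds ?_)
    rwa [Complex.norm_real, Real.norm_of_nonneg ht.le]
  filter_upwards [nhdsWithin_le_nhds harg, nhdsWithin_le_nhds hnorm, self_mem_nhdsWithin]
    with η h1 h2 hη
  have hη' : 0 < η := hη
  set w : ℂ := t + η * Complex.I with hw
  have him : w.im = η := by simp [hw]
  have hw0 : w ≠ 0 := fun h => hη'.ne' (by rw [← him, h]; rfl)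
  have hw' := Complex.norm_mul_exp_arg_mul_I w
  refine ⟨‖w‖, Complex.arg w, norm_pos_iff.2 hw0, h2, ?_, h1, hw'.symm, ?_⟩
  · refine lt_of_le_of_ne (Complex.arg_nonneg_iff.2 (by rw [him]; exact hη'.le)) fun h => ?_
    have := (Complex.arg_eq_zero_iff.1 h.symm).2
    exact hη'.ne' (him ▸ this)
  · have h3 : (t - η * Complex.I : ℂ) = (starRingEnd ℂ) w := by
      simp [hw, sub_eq_add_neg]
    rw [h3]
    conv_lhs => rw [← hw']
    rw [map_mul, Complex.conj_ofReal, ← Complex.exp_conj]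
    simp

/-- The face on the right of an edge into `b` is also on the right of an edge out of `b`, which is
not the same edge if `b` has another neighbor. -/
lemma IsPlaneGraph.exists_next (hH : IsPlaneGraph H) (hab : H.Adj a b) :
    ∃ c, H.Adj b c ∧ face H b c = face H a b ∧ ((∃ c', c' ≠ a ∧ H.Adj b c') → c ≠ a) := by
  have hr : a - b ≠ 0 := sub_ne_zero.2 hab.ne
  have hfin : {c | H.Adj b c}.Finite := by
    refine (hH.finite.image Prod.snd).subset fun c hc => ⟨(b, c), hc, rfl⟩
  -- `c` is the end of the first edge at `b` counterclockwise from the edge to `a`, which is the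
  -- turn towards the right of the segment from `a` to `b`. The range `(0, 2π]` puts `a` itself,
  -- with ratio 1, last.
  obtain ⟨c, hbc, hmin⟩ := Set.exists_min_image _ (fun c => posArg ((c - b) / (a - b))) hfin
    ⟨a, hab.symm⟩
  simp only [Set.mem_ofPred_eq] at hbc hmin
  refine ⟨c, hbc, ?_, ?_⟩
  swap
  · rintro ⟨c', hc', hbc'⟩ rfl
    have h1 := hH.posArg_lt hab hbc' hc'
    have h2 := hmin c' hbc'
    rw [div_self hr, posArg_one] at h2
    linarith
  set θ₁ := posArg ((c - b) / (a - b)) with hθ₁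
  have hθ0 : 0 < θ₁ := posArg_pos _
  have hθ2 : θ₁ ≤ 2 * Real.pi := posArg_le _
  -- a disc around `b` that meets no edge away from `b`
  have hO := (hH.isClosed fun d => b ≠ d.1 ∧ b ≠ d.2).isOpen_compl
  obtain ⟨ε, hε, hball⟩ := Metric.isOpen_iff.1 hO b (by
    rintro ⟨d, hd, ⟨h1, h2⟩, hz⟩
    rcases hH.cross a b d.1 d.2 hab hd b (right_mem_segment ℝ a b) hz with h | h
    · rcases Sym2.eq_iff.1 h with ⟨-, h⟩ | ⟨-, h⟩
      · exact h2 h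
      · exact h1 h
    · exact h.2.elim h1 h2)
  have hrn : 0 < ‖a - b‖ := norm_pos_iff.2 hr
  set P := ε / ‖a - b‖ with hP
  have hPpos : 0 < P := div_pos hε hrn
  set φ : ℝ × ℝ → ℂ := fun p => b + (a - b) * (p.1 * Complex.exp (p.2 * Complex.I)) with hφ
  have hφc : Continuous φ := by fun_prop
  -- This open sector between the two edges is connected and, by minimality of `θ₁`, avoids the
  -- drawing. It contains points beside both edges, so their right faces agree.
  set A : Set ℂ := φ '' (Set.Ioo 0 P ×ˢ Set.Ioo 0 θ₁) with hA
  have hApre : IsPreconnected A :=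
    (isPreconnected_Ioo.prod isPreconnected_Ioo).image _ hφc.continuousOn
  have hAK : A ⊆ (drawing H)ᶜ := by
    rintro _ ⟨⟨ρ, θ⟩, ⟨hρ, hθ⟩, rfl⟩ ⟨d, hd, hz⟩
    simp only [Set.mem_Ioo] at hρ hθ
    have hstar : ∀ y, H.Adj b y → φ (ρ, θ) ∉ segment ℝ b y := by
      intro y hby hy
      obtain ⟨s, hs0, -, hs⟩ := mem_segment_iff_exists.1 hy
      have h1 : (a - b) * (ρ * Complex.exp (θ * Complex.I)) = (y - b) * s := add_left_cancel hs
      have hs1 : s ≠ 0 := by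
        rintro rfl
        rw [Complex.ofReal_zero, mul_zero] at h1
        rcases mul_eq_zero.1 h1 with h | h
        · exact hr h
        · rcases mul_eq_zero.1 h with h | h
          · exact hρ.1.ne' (by exact_mod_cast h)
          · exact Complex.exp_ne_zero _ h
      have hs2 : (s : ℂ) ≠ 0 := by exact_mod_cast hs1
      have h2 : (y - b) / (a - b) = ((ρ / s : ℝ) : ℂ) * Complex.exp (θ * Complex.I) := by
        rw [div_eq_iff hr]
        push_cast
        field_simp
        linear_combination -h1
      have h3 := hmin y hby
      rw [h2, posArg_polar (div_pos hρ.1 (lt_of_le_of_ne hs0 hs1.symm)) hθ.1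
        (hθ.2.le.trans hθ2)] at h3
      linarith [hθ.2]
    by_cases h1 : b = d.1
    · rw [← h1] at hd hz
      exact hstar _ hd hz
    · by_cases h2 : b = d.2
      · rw [← h2] at hd hz
        rw [segment_symm] at hz
        exact hstar _ hd.symm hz
      · refine hball ?_ ⟨d, hd, ⟨h1, h2⟩, hz⟩
        rw [Metric.mem_ball, dist_eq_norm]
        simp only [hφ, add_sub_cancel_left, norm_mul, Complex.norm_real,
          Complex.norm_exp_ofReal_mul_I, mul_one, Real.norm_of_nonneg hρ.1.le]
        rw [mul_comm]
        exact (lt_div_iff₀ hrn).1 hρ.2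
  -- a point of the sector on the right of the segment from `a` to `b`
  obtain ⟨t, ht0, ht1⟩ : ∃ t : ℝ, 0 < t ∧ t < min P 1 := exists_between (lt_min hPpos one_pos)
  have ht1' := ht1.trans_le (min_le_right _ _)
  obtain ⟨η, ⟨ρ, θ, hρ, hρP, hθ, hθQ, hw, -⟩, hf⟩ :=
    ((exists_polar_of_near hθ0 ht0 (ht1.trans_le (min_le_left _ _))).and
      (hH.face_spec hab (1 - t) ⟨by linarith, by linarith⟩)).exists
  have hp1 : sidePt a b (1 - t) η ∈ A := by
    refine ⟨(ρ, θ), ⟨⟨hρ, hρP⟩, ⟨hθ, hθQ⟩⟩, ?_⟩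
    simp only [hφ, sidePt, ← hw]
    push_cast
    ring
  -- a point of the sector on the right of the segment from `b` to `c`
  set q := ‖(c - b) / (a - b)‖ with hq
  have hqpos : 0 < q := norm_pos_iff.2 (div_ne_zero (sub_ne_zero.2 hbc.ne.symm) hr)
  have hcb : c - b = (a - b) * (q * Complex.exp (θ₁ * Complex.I)) := by
    rw [hq, hθ₁, norm_mul_exp_posArg, mul_div_cancel₀ _ hr]
  have hPq : 0 < P / q := div_pos hPpos hqpos
  obtain ⟨t', ht0', ht1'⟩ : ∃ t : ℝ, 0 < t ∧ t < min (P / q) 1 := exists_between (lt_min hPq one_pos)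
  obtain ⟨η', ⟨ρ', θ', hρ', hρP', hθ', hθQ', -, hw'⟩, hf'⟩ :=
    ((exists_polar_of_near hθ0 ht0' (ht1'.trans_le (min_le_left _ _))).and
      (hH.face_spec hbc t' ⟨ht0', ht1'.trans_le (min_le_right _ _)⟩)).exists
  have hp2 : sidePt b c t' η' ∈ A := by
    refine ⟨(q * ρ', θ₁ - θ'), ⟨⟨mul_pos hqpos hρ', ?_⟩, ⟨by simpa using hθQ', by simpa using hθ'⟩⟩, ?_⟩
    · rw [mul_comm]
      exact (lt_div_iff₀ hqpos).1 hρP'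
    · have he : Complex.exp ((θ₁ - θ' : ℝ) * Complex.I) =
          Complex.exp (θ₁ * Complex.I) * Complex.exp ((-θ' : ℝ) * Complex.I) := by
        rw [← Complex.exp_add]
        push_cast
        ring_nf
      simp only [hφ, sidePt, hw', hcb, he]
      push_cast
      ring
  rw [← hf.2, ← hf'.2]
  exact connectedComponentIn_eq_of_isPreconnected hApre hAK hp2 hp1

end PlaneGraph

/-! ### Crossings of a vertical ray with a segment, modulo 2 -/

section Parity

/-- The indicator of the closed half-plane on the right of `p`. -/
noncomputable def rightOf (p z : ℂ) : ZMod 2 := if p.re ≤ z.re then 1 else 0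

/-- The height of `z` below the line through `a` and `b`. -/
noncomputable def depth (a b z : ℂ) : ℝ :=
  a.im + (b.im - a.im) / (b.re - a.re) * (z.re - a.re) - z.im

/-- The indicator of the crossing of the segment from `a` to `b` with the upward ray from `z`. -/
noncomputable def crossing (a b z : ℂ) : ZMod 2 :=
  (rightOf a z + rightOf b z) * if 0 < depth a b z then 1 else 0

/-- The change of the crossing indicators caused by the end `p` when a point moves from `z₀` to
`z`. -/
noncomputable def endChange (z₀ z p : ℂ) : ZMod 2 :=
  (rightOf p z - rightOf p z₀) * if p.re = z₀.re ∧ z₀.im < p.im then 1 else 0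

lemma continuous_depth (a b : ℂ) : Continuous (depth a b) := by
  unfold depth; fun_prop

lemma eventually_rightOf_eq {p z₀ : ℂ} (h : p.re ≠ z₀.re) :
    ∀ᶠ z in 𝓝 z₀, rightOf p z = rightOf p z₀ := by
  rcases lt_or_gt_of_ne h with h | h
  · filter_upwards [Complex.continuous_re.continuousAt.eventually (lt_mem_nhds h)] with z hz
    simp [rightOf, h.le, hz.le]
  · filter_upwards [Complex.continuous_re.continuousAt.eventually (gt_mem_nhds h)] with z hz
    simp [rightOf, not_le.2 h, not_le.2 hz]

lemma endChange_of_ne {p z₀ z : ℂ} (h : p.re ≠ z₀.re) : endChange z₀ z p = 0 := by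
  simp [endChange, h]

lemma mem_segment_of_depth_eq_zero {a b z : ℂ} (hab : a.re ≠ b.re) (h : depth a b z = 0)
    (h0 : 0 ≤ (z.re - a.re) / (b.re - a.re)) (h1 : (z.re - a.re) / (b.re - a.re) ≤ 1) :
    z ∈ segment ℝ a b := by
  refine mem_segment_iff_exists.2 ⟨_, h0, h1, ?_⟩
  have hne : b.re - a.re ≠ 0 := sub_ne_zero.2 hab.symm
  unfold depth at h
  apply Complex.ext
  · simp only [Complex.add_re, Complex.re_mul_ofReal, Complex.sub_re]
    field_simp
    ring
  · simp only [Complex.add_im, Complex.im_mul_ofReal, Complex.sub_im]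
    have : (b.im - a.im) * ((z.re - a.re) / (b.re - a.re)) =
        (b.im - a.im) / (b.re - a.re) * (z.re - a.re) := by ring
    linarith

lemma depth_of_re_eq_left {a b z : ℂ} (h : a.re = z.re) : depth a b z = a.im - z.im := by
  simp [depth, h]

lemma depth_of_re_eq_right {a b z : ℂ} (hab : a.re ≠ b.re) (h : b.re = z.re) :
    depth a b z = b.im - z.im := by
  unfold depth
  rw [← h, div_mul_cancel₀ _ (sub_ne_zero.2 hab.symm)]
  ring

/-- The change is a sum of terms that depend on one end only and not on the segment. Therefore it
cancels at every point where an even number of segments meet. -/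
lemma eventually_crossing {a b z₀ : ℂ} (hab : a.re ≠ b.re) (hz : z₀ ∉ segment ℝ a b) :
    ∀ᶠ z in 𝓝 z₀, crossing a b z = crossing a b z₀ + (endChange z₀ z a + endChange z₀ z b) := by
  by_cases hd : depth a b z₀ = 0
  · have hane : a.re ≠ z₀.re := fun h => hz (by
      refine mem_segment_of_depth_eq_zero hab hd ?_ ?_ <;> simp [h])
    have hbne : b.re ≠ z₀.re := fun h => hz (by
      have : b.re - a.re ≠ 0 := sub_ne_zero.2 hab.symm
      refine mem_segment_of_depth_eq_zero hab hd ?_ ?_ <;> rw [← h, div_self this]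
      exact zero_le_one)
    -- A point on the line but off the segment lies to the left or to the right of both ends.
    have hsame : rightOf a z₀ + rightOf b z₀ = 0 := by
      have hnb : ¬ (0 ≤ (z₀.re - a.re) / (b.re - a.re) ∧ (z₀.re - a.re) / (b.re - a.re) ≤ 1) :=
        fun h => hz (mem_segment_of_depth_eq_zero hab hd h.1 h.2)
      unfold rightOf
      by_cases h1 : a.re ≤ z₀.re <;> by_cases h2 : b.re ≤ z₀.re
      · simp only [h1, h2, if_true]; exact CharTwo.add_self_eq_zero 1
      · exfalso
        have h2' := not_le.1 h2
        have h3 : 0 < b.re - a.re := by linarith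
        exact hnb ⟨div_nonneg (by linarith) h3.le, (div_le_one h3).2 (by linarith)⟩
      · exfalso
        have h1' := not_le.1 h1
        have h3 : b.re - a.re < 0 := by linarith
        exact hnb ⟨div_nonneg_of_nonpos (by linarith) h3.le,
          (div_le_one_of_neg h3).2 (by linarith)⟩
      · simp [h1, h2]
    filter_upwards [eventually_rightOf_eq hane, eventually_rightOf_eq hbne] with z h1 h2
    rw [endChange_of_ne hane, endChange_of_ne hbne, crossing, crossing, h1, h2, hsame]
    simp
  · have hsign : ∀ᶠ z in 𝓝 z₀, (0 < depth a b z ↔ 0 < depth a b z₀) := by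
      rcases lt_or_gt_of_ne hd with h | h
      · filter_upwards [(continuous_depth a b).continuousAt.eventually (gt_mem_nhds h)] with z hz'
        simp [not_lt.2 h.le, not_lt.2 hz'.le]
      · filter_upwards [(continuous_depth a b).continuousAt.eventually (lt_mem_nhds h)] with z hz'
        simp [h, hz']
    have hend : ∀ p, (p.re = z₀.re → depth a b z₀ = p.im - z₀.im) → ∀ᶠ z in 𝓝 z₀,
        endChange z₀ z p = (rightOf p z - rightOf p z₀) * if 0 < depth a b z₀ then 1 else 0 := by
      intro p hp
      by_cases h : p.re = z₀.re
      · refine Filter.Eventually.of_forall fun z => ?_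
        rw [endChange, hp h]
        simp [h]
      · filter_upwards [eventually_rightOf_eq h] with z hz'
        simp [endChange, hz']
    filter_upwards [hsign, hend a depth_of_re_eq_left, hend b (depth_of_re_eq_right hab)]
      with z h1 h2 h3
    rw [h2, h3, crossing, crossing]
    simp only [h1]
    ring

lemma sidePt_re (a b : ℂ) (t η : ℝ) :
    (sidePt a b t η).re = a.re + ((b.re - a.re) * t + (b.im - a.im) * η) := by
  simp [sidePt]

lemma sidePt_im (a b : ℂ) (t η : ℝ) :
    (sidePt a b t η).im = a.im + ((b.im - a.im) * t - (b.re - a.re) * η) := by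
  simp [sidePt]; ring

/-- The depth is a nonzero multiple of `η`, so it changes sign across the segment. -/
lemma depth_sidePt {a b : ℂ} (hab : a.re ≠ b.re) (t η : ℝ) : depth a b (sidePt a b t η) =
    η * (((b.re - a.re) ^ 2 + (b.im - a.im) ^ 2) / (b.re - a.re)) := by
  have : b.re - a.re ≠ 0 := sub_ne_zero.2 hab.symm
  rw [depth, sidePt_re, sidePt_im]
  field_simp
  ring

lemma tendsto_sidePt (a b : ℂ) (t : ℝ) :
    Filter.Tendsto (fun η : ℝ => sidePt a b t η) (𝓝 0) (𝓝 (sidePt a b t 0)) :=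
  ((continuous_sidePt a b).comp (by fun_prop : Continuous fun η : ℝ => (t, η))).tendsto 0

/-- Points on different sides of a segment have different crossing indicators. -/
lemma eventually_crossing_jump {a b : ℂ} (hab : a.re ≠ b.re) {t : ℝ} (h0 : 0 < t) (h1 : t < 1) :
    ∀ᶠ η : ℝ in 𝓝[>] 0,
      crossing a b (sidePt a b t η) + crossing a b (sidePt a b t (-η)) = 1 := by
  set m := sidePt a b t 0
  have hm : m.re = a.re + (b.re - a.re) * t := by simp [m, sidePt_re]
  have hne : b.re - a.re ≠ 0 := sub_ne_zero.2 hab.symm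
  have ha : a.re ≠ m.re := by
    rw [hm]
    intro h
    have : (b.re - a.re) * t = 0 := by linarith
    exact (mul_ne_zero hne h0.ne') this
  have hb : b.re ≠ m.re := by
    rw [hm]
    intro h
    have : (b.re - a.re) * (1 - t) = 0 := by linarith
    exact (mul_ne_zero hne (by linarith)) this
  have hsum : rightOf a m + rightOf b m = 1 := by
    unfold rightOf
    rcases lt_or_gt_of_ne hab with h | h
    · have h2 : a.re ≤ m.re := by
        rw [hm]; have := mul_nonneg (sub_nonneg.2 h.le) h0.le; linarith
      have h3 : ¬ b.re ≤ m.re := by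
        rw [hm]; have := mul_pos (sub_pos.2 h) (sub_pos.2 h1); linarith
      simp [h2, h3]
    · have h2 : b.re ≤ m.re := by
        rw [hm]; have := mul_pos (sub_pos.2 h) (sub_pos.2 h1); linarith
      have h3 : ¬ a.re ≤ m.re := by
        rw [hm]; have := mul_pos (sub_pos.2 h) h0; linarith
      simp [h2, h3]
  have hR : ∀ᶠ z in 𝓝 m, rightOf a z + rightOf b z = 1 := by
    filter_upwards [eventually_rightOf_eq ha, eventually_rightOf_eq hb] with z h2 h3
    rw [h2, h3, hsum]
  have hneg : Filter.Tendsto (fun η : ℝ => sidePt a b t (-η)) (𝓝 0) (𝓝 m) := by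
    have : Filter.Tendsto (fun η : ℝ => -η) (𝓝 0) (𝓝 0) := by
      simpa using (continuous_neg (G := ℝ)).tendsto 0
    exact (tendsto_sidePt a b t).comp this
  filter_upwards [nhdsWithin_le_nhds ((tendsto_sidePt a b t).eventually hR),
    nhdsWithin_le_nhds (hneg.eventually hR), self_mem_nhdsWithin] with η h2 h3 hη
  have hη' : 0 < η := hη
  rw [crossing, crossing, h2, h3, depth_sidePt hab, depth_sidePt hab]
  set q := ((b.re - a.re) ^ 2 + (b.im - a.im) ^ 2) / (b.re - a.re)
  have hq : q ≠ 0 := div_ne_zero (by positivity) hne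
  rcases lt_or_gt_of_ne hq with h | h
  · have e1 : ¬ 0 < η * q := not_lt.2 (mul_neg_of_pos_of_neg hη' h).le
    have e2 : 0 < -η * q := mul_pos_of_neg_of_neg (neg_neg_of_pos hη') h
    simp only [if_neg e1, if_pos e2]; ring
  · have e1 : 0 < η * q := mul_pos hη' h
    have e2 : ¬ 0 < -η * q := not_lt.2 (mul_neg_of_neg_of_pos (neg_neg_of_pos hη') h).le
    simp only [if_pos e1, if_neg e2]; ring

end Parity

/-! ### Polygonal drawings and the faces along their edges -/

section Polylines

/-- A drawing of `G` in the plane by polygonal arcs without vertical segments. -/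
structure PolylineDrawing {V : Type*} (G : SimpleGraph V) where
  /-- the point representing a vertex -/
  pos : V → ℂ
  /-- the first end of an edge -/
  src : G.edgeSet → V
  /-- the last end of an edge -/
  tgt : G.edgeSet → V
  /-- the number of segments of an edge -/
  len : G.edgeSet → ℕ
  /-- the ends of the segments of an edge -/
  node : G.edgeSet → ℕ → ℂ
  ends : ∀ e : G.edgeSet, (e : Sym2 V) = s(src e, tgt e)
  pos_injective : Function.Injective pos
  len_pos : ∀ e, 0 < len e
  node_zero : ∀ e, node e 0 = pos (src e)
  node_len : ∀ e, node e (len e) = pos (tgt e)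
  re_ne : ∀ e, ∀ i < len e, (node e i).re ≠ (node e (i + 1)).re
  cross : ∀ e, ∀ i < len e, ∀ f, ∀ j < len f, (e, i) ≠ (f, j) →
    ∀ x ∈ segment ℝ (node e i) (node e (i + 1)), x ∈ segment ℝ (node f j) (node f (j + 1)) →
      (x = node e i ∨ x = node e (i + 1)) ∧ (x = node f j ∨ x = node f (j + 1))
  node_eq : ∀ e, ∀ i ≤ len e, ∀ f, ∀ j ≤ len f, node e i = node f j →
    (e, i) = (f, j) ∨ ((i = 0 ∨ i = len e) ∧ (j = 0 ∨ j = len f))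

namespace PolylineDrawing

variable {V : Type*} {G : SimpleGraph V} (D : PolylineDrawing G)

/-- The graph formed by the segments of the drawing. -/
def graph : SimpleGraph ℂ where
  Adj a b := ∃ e, ∃ i < D.len e, s(a, b) = s(D.node e i, D.node e (i + 1))
  symm := ⟨fun a b ⟨e, i, hi, h⟩ => ⟨e, i, hi, by rw [Sym2.eq_swap, h]⟩⟩
  loopless := ⟨fun a ⟨e, i, hi, h⟩ => D.re_ne e i hi (by
    rcases Sym2.eq_iff.1 h with ⟨h1, h2⟩ | ⟨h1, h2⟩ <;> rw [← h1, ← h2])⟩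

variable {D}

lemma adj_node (e : G.edgeSet) {i : ℕ} (hi : i < D.len e) :
    D.graph.Adj (D.node e i) (D.node e (i + 1)) := ⟨e, i, hi, rfl⟩

lemma src_ne_tgt (e : G.edgeSet) : D.src e ≠ D.tgt e := by
  have := e.2
  rw [D.ends e, SimpleGraph.mem_edgeSet] at this
  exact this.ne

lemma node_injOn (e : G.edgeSet) {i j : ℕ} (hi : i ≤ D.len e) (hj : j ≤ D.len e)
    (h : D.node e i = D.node e j) : i = j := by
  rcases D.node_eq e i hi e j hj h with h' | ⟨h1, h2⟩
  · exact (Prod.mk.inj h').2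
  · have hne : D.node e 0 ≠ D.node e (D.len e) := by
      rw [D.node_zero, D.node_len]
      exact fun h => src_ne_tgt e (D.pos_injective h)
    rcases h1 with rfl | rfl <;> rcases h2 with rfl | rfl
    · rfl
    · exact absurd h hne
    · exact absurd h.symm hne
    · rfl

/-- Distinct segments meet only in ends, but equal ones would share their midpoint. -/
lemma segment_injective {e f : G.edgeSet} {i j : ℕ} (hi : i < D.len e) (hj : j < D.len f)
    (h : s(D.node e i, D.node e (i + 1)) = s(D.node f j, D.node f (j + 1))) : (e, i) = (f, j) := by
  by_contra hne
  have hs : segment ℝ (D.node e i) (D.node e (i + 1)) =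
      segment ℝ (D.node f j) (D.node f (j + 1)) := by
    rcases Sym2.eq_iff.1 h with ⟨h1, h2⟩ | ⟨h1, h2⟩
    · rw [h1, h2]
    · rw [h1, h2, segment_symm]
  have hm := sidePt_zero_mem (a := D.node e i) (b := D.node e (i + 1)) (t := 1 / 2)
    (by norm_num) (by norm_num)
  have hn := sidePt_zero_ne (adj_node e hi).ne (t := 1 / 2) (by norm_num) (by norm_num)
  rcases (D.cross e i hi f j hj hne _ hm (hs ▸ hm)).1 with h | h
  · exact hn.1 h
  · exact hn.2 h

lemma isPlaneGraph [Finite V] : IsPlaneGraph D.graph := by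
  have : Finite G.edgeSet := Set.toFinite _
  constructor
  · have hfin : (⋃ e, ⋃ i ∈ Finset.range (D.len e), {d : ℂ × ℂ | d =
        (D.node e i, D.node e (i + 1)) ∨ d = (D.node e (i + 1), D.node e i)}).Finite := by
      refine Set.finite_iUnion fun e => Set.Finite.biUnion (Finset.finite_toSet _) fun i _ => ?_
      exact (Set.toFinite {(D.node e i, D.node e (i + 1)), (D.node e (i + 1), D.node e i)})
    refine hfin.subset ?_
    rintro ⟨a, b⟩ ⟨e, i, hi, h⟩
    simp only [Set.mem_iUnion]
    refine ⟨e, i, Finset.mem_range.2 hi, ?_⟩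
    rcases Sym2.eq_iff.1 h with ⟨h1, h2⟩ | ⟨h1, h2⟩
    · left; exact Prod.ext h1 h2
    · right; exact Prod.ext h1 h2
  · rintro a b c d ⟨e, i, hi, h1⟩ ⟨f, j, hj, h2⟩ x hx hx'
    by_cases hne : (e, i) = (f, j)
    · left
      cases hne
      rw [h1, h2]
    · right
      have hs : ∀ {p q r s : ℂ}, s(p, q) = s(r, s) → segment ℝ p q = segment ℝ r s := by
        intro p q r s h
        rcases Sym2.eq_iff.1 h with ⟨rfl, rfl⟩ | ⟨rfl, rfl⟩
        · rfl
        · exact segment_symm _ _ _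
      rw [hs h1] at hx
      rw [hs h2] at hx'
      have h := D.cross e i hi f j hj hne x hx hx'
      have hm : ∀ {p q r s : ℂ}, s(p, q) = s(r, s) → (x = r ∨ x = s) → (x = p ∨ x = q) := by
        intro p q r s h h'
        rcases Sym2.eq_iff.1 h with ⟨rfl, rfl⟩ | ⟨rfl, rfl⟩
        · exact h'
        · exact h'.symm
      exact ⟨hm h1 h.1, hm h2 h.2⟩

lemma eq_of_adj_node {e : G.edgeSet} {i : ℕ} (hi : i + 1 < D.len e) {c : ℂ}
    (h : D.graph.Adj (D.node e (i + 1)) c) : c = D.node e i ∨ c = D.node e (i + 2) := by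
  obtain ⟨f, j, hj, h⟩ := h
  have key : ∀ k ≤ D.len f, D.node e (i + 1) = D.node f k → (e, i + 1) = (f, k) := by
    intro k hk hek
    rcases D.node_eq e (i + 1) hi.le f k hk hek with h | ⟨h, -⟩
    · exact h
    · omega
  rcases Sym2.eq_iff.1 h with ⟨h1, h2⟩ | ⟨h1, h2⟩
  · cases key j hj.le h1
    exact Or.inr h2
  · obtain ⟨rfl, h3⟩ := Prod.mk.inj (key (j + 1) hj h1)
    obtain rfl : i = j := by omega
    exact Or.inl h2

/-- An inner node of an arc has only the two neighbors on the arc, so the next segment around the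
face cannot leave the arc. -/
lemma face_node_eq [Finite V] (e : G.edgeSet) {i : ℕ} (hi : i < D.len e) :
    face D.graph (D.node e i) (D.node e (i + 1)) = face D.graph (D.node e 0) (D.node e 1) := by
  induction i with
  | zero => rfl
  | succ i ih =>
    rw [← ih (by omega)]
    obtain ⟨c, hc, hf, hne⟩ := D.isPlaneGraph.exists_next (adj_node e (by omega : i < D.len e))
    have h := hne ⟨D.node e (i + 2), fun h => by
      have := node_injOn e (by omega) (by omega) h
      omega, adj_node e hi⟩
    rw [← hf]
    rcases eq_of_adj_node hi hc with h' | h'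
    · exact absurd h' h
    · rw [h']

lemma face_node_eq' [Finite V] (e : G.edgeSet) {i : ℕ} (hi : i < D.len e) :
    face D.graph (D.node e (i + 1)) (D.node e i) = face D.graph (D.node e 1) (D.node e 0) := by
  induction i with
  | zero => rfl
  | succ i ih =>
    rw [← ih (by omega)]
    obtain ⟨c, hc, hf, hne⟩ := D.isPlaneGraph.exists_next (adj_node e hi).symm
    have h := hne ⟨D.node e i, fun h => by
      have := node_injOn e (by omega) (by omega) h
      omega, (adj_node e (by omega)).symm⟩
    rw [← hf]
    rcases eq_of_adj_node hi hc with h' | h'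
    · rw [h']
    · exact absurd h' h

variable (D) in
/-- The tail of an oriented edge. -/
def tail (d : G.edgeSet × Bool) : V := if d.2 then D.src d.1 else D.tgt d.1

variable (D) in
/-- The head of an oriented edge. -/
def head (d : G.edgeSet × Bool) : V := if d.2 then D.tgt d.1 else D.src d.1

variable (D) in
/-- The face on the right of an oriented edge. -/
noncomputable def dartFace (d : G.edgeSet × Bool) : Set ℂ :=
  if d.2 then face D.graph (D.node d.1 0) (D.node d.1 1)
  else face D.graph (D.node d.1 1) (D.node d.1 0)

variable (D) in
/-- The index of the first segment of an oriented edge. -/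
def firstIdx (d : G.edgeSet × Bool) : ℕ := if d.2 then 0 else D.len d.1 - 1

variable (D) in
/-- The first node after the tail of an oriented edge. -/
def second (d : G.edgeSet × Bool) : ℂ :=
  if d.2 then D.node d.1 1 else D.node d.1 (D.len d.1 - 1)

/-- The reverse of an oriented edge. -/
def rev (d : G.edgeSet × Bool) : G.edgeSet × Bool := (d.1, !d.2)

lemma tail_rev (d : G.edgeSet × Bool) : D.tail (rev d) = D.head d := by
  rcases d with ⟨e, _ | _⟩ <;> rfl

lemma firstIdx_lt (d : G.edgeSet × Bool) : D.firstIdx d < D.len d.1 := by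
  have := D.len_pos d.1
  unfold firstIdx
  split_ifs <;> omega

lemma first_segment (d : G.edgeSet × Bool) : s(D.pos (D.tail d), D.second d) =
    s(D.node d.1 (D.firstIdx d), D.node d.1 (D.firstIdx d + 1)) := by
  rcases d with ⟨e, _ | _⟩
  · have := D.len_pos e
    simp only [tail, second, firstIdx, Bool.false_eq_true, if_false]
    rw [← D.node_len, Sym2.eq_swap, Nat.sub_add_cancel this]
  · simp [tail, second, firstIdx, D.node_zero]

lemma dartFace_eq [Finite V] (d : G.edgeSet × Bool) :
    D.dartFace d = face D.graph (D.pos (D.tail d)) (D.second d) := by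
  rcases d with ⟨e, _ | _⟩
  · have := D.len_pos e
    simp only [dartFace, tail, second, Bool.false_eq_true, if_false]
    rw [← face_node_eq' e (i := D.len e - 1) (by omega), ← D.node_len, Nat.sub_add_cancel this]
  · simp [dartFace, tail, second, D.node_zero]

lemma dartFace_eq_rev [Finite V] (d : G.edgeSet × Bool) :
    D.dartFace d = face D.graph (D.second (rev d)) (D.pos (D.head d)) := by
  rcases d with ⟨e, _ | _⟩
  · simp [dartFace, head, second, rev, D.node_zero]
  · have := D.len_pos e
    simp only [dartFace, head, second, rev, if_true, Bool.not_true, Bool.false_eq_true, if_false]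
    rw [← face_node_eq e (i := D.len e - 1) (by omega), ← D.node_len, Nat.sub_add_cancel this]

/-- A segment at a vertex is the first segment of an oriented edge. -/
lemma exists_dart_of_adj {d : G.edgeSet × Bool} {c : ℂ} (h : D.graph.Adj (D.pos (D.tail d)) c) :
    ∃ d', D.tail d' = D.tail d ∧ D.second d' = c := by
  obtain ⟨f, j, hj, h⟩ := h
  have key : ∀ k ≤ D.len f, D.pos (D.tail d) = D.node f k → k = 0 ∨ k = D.len f := by
    intro k hk h
    obtain ⟨i, hi, hie, hin⟩ : ∃ i ≤ D.len d.1, (i = 0 ∨ i = D.len d.1) ∧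
        D.node d.1 i = D.pos (D.tail d) := by
      rcases d with ⟨e, _ | _⟩
      · exact ⟨D.len e, le_rfl, Or.inr rfl, D.node_len e⟩
      · exact ⟨0, Nat.zero_le _, Or.inl rfl, D.node_zero e⟩
    rcases D.node_eq d.1 i hi f k hk (hin.trans h) with h' | h'
    · cases h'; exact hie
    · exact h'.2
  rcases Sym2.eq_iff.1 h with ⟨h1, h2⟩ | ⟨h1, h2⟩
  · obtain rfl : j = 0 := by have := key j hj.le h1; omega
    refine ⟨(f, true), D.pos_injective ?_, ?_⟩
    · rw [h1, D.node_zero]; rfl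
    · rw [h2]; rfl
  · have hj' : j + 1 = D.len f := by have := key (j + 1) hj h1; omega
    refine ⟨(f, false), D.pos_injective ?_, ?_⟩
    · rw [h1, hj', D.node_len]; rfl
    · rw [h2, second, ← hj']; rfl

/-- The face on the right of an oriented edge is also on the right of an oriented edge that starts
at its head and is not its reverse, if there is a further edge at this vertex. -/
lemma exists_next_dart [Finite V] (d : G.edgeSet × Bool) (h : ∃ d', D.tail d' = D.head d ∧ d'.1 ≠ d.1) :
    ∃ d', D.tail d' = D.head d ∧ d' ≠ rev d ∧ D.dartFace d' = D.dartFace d := by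
  have hadj : ∀ d, D.graph.Adj (D.pos (D.tail d)) (D.second d) := fun d =>
    ⟨d.1, D.firstIdx d, firstIdx_lt d, first_segment d⟩
  have h1 := (hadj (rev d)).symm
  rw [tail_rev] at h1
  obtain ⟨c, hc, hf, hne⟩ := D.isPlaneGraph.exists_next h1
  obtain ⟨d', ht, hd'⟩ := exists_dart_of_adj (D := D) (d := rev d) (c := c) (by rwa [tail_rev])
  rw [tail_rev] at ht
  have hcne : c ≠ D.second (rev d) := by
    obtain ⟨d'', ht'', hd''⟩ := h
    refine hne ⟨D.second d'', fun h => hd'' ?_, ht'' ▸ hadj d''⟩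
    have h2 := first_segment (D := D) d''
    rw [h, ht'', ← tail_rev, first_segment] at h2
    exact (Prod.mk.inj (segment_injective (firstIdx_lt _) (firstIdx_lt _) h2)).1.symm
  refine ⟨d', ht, ?_, ?_⟩
  · rintro rfl
    exact hcne hd'.symm
  · rw [dartFace_eq, ht, hd', hf, ← dartFace_eq_rev]

end PolylineDrawing

end Polylines

/-! ### The cycle space, Euler's inequality and face lengths -/

namespace PolylineDrawing

variable {V : Type*} {G : SimpleGraph V} {D : PolylineDrawing G}

lemma sum_range_add_succ (k : ℕ → ZMod 2) (n : ℕ) :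
    ∑ i ∈ Finset.range n, (k i + k (i + 1)) = k 0 + k n := by
  induction n with
  | zero => simp [CharTwo.add_self_eq_zero]
  | succ n ih =>
    rw [Finset.sum_range_succ, ih]
    have := CharTwo.add_self_eq_zero (k n)
    linear_combination this

lemma notMem_segment {z : ℂ} (hz : z ∈ (drawing D.graph)ᶜ) (e : G.edgeSet) {i : ℕ}
    (hi : i < D.len e) : z ∉ segment ℝ (D.node e i) (D.node e (i + 1)) :=
  fun h => hz ⟨(_, _), adj_node e hi, h⟩

lemma sidePt_symm (a b : ℂ) (t η : ℝ) : sidePt b a (1 - t) η = sidePt a b t (-η) := by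
  unfold sidePt; push_cast; ring

lemma adj_tail_head (d : G.edgeSet × Bool) : G.Adj (D.tail d) (D.head d) := by
  have h := d.1.2
  rw [D.ends d.1, SimpleGraph.mem_edgeSet] at h
  rcases d with ⟨e, _ | _⟩
  · exact h.symm
  · exact h

lemma edge_eq (d : G.edgeSet × Bool) : (d.1 : Sym2 V) = s(D.tail d, D.head d) := by
  rcases d with ⟨e, _ | _⟩
  · rw [Sym2.eq_swap]; exact D.ends e
  · exact D.ends e

/-- Returning to the tail would use the same edge of the simple graph, in one of its two
orientations; both are excluded. -/
lemma head_ne_of_ne_rev {d d' : G.edgeSet × Bool} (ht : D.tail d' = D.head d)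
    (hne : d' ≠ rev d) : D.head d' ≠ D.tail d := by
  intro h
  have he : d'.1 = d.1 := Subtype.ext (by
    rw [edge_eq (D := D) d, edge_eq (D := D) d', ht, h, Sym2.eq_swap])
  refine hne (Prod.ext he ?_)
  by_contra hb
  have : d' = d := Prod.ext he (by simpa [rev] using hb)
  rw [this] at ht
  exact (adj_tail_head d).ne ht

variable [Fintype V] [Fintype G.edgeSet] (D)

/-- The parity of the number of crossings of the upward ray from `z` with the edges in `Z`. -/
noncomputable def parity (Z : G.edgeSet → ZMod 2) (z : ℂ) : ZMod 2 :=
  ∑ e, Z e * ∑ i ∈ Finset.range (D.len e), crossing (D.node e i) (D.node e (i + 1)) z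

/-- The boundary map of `G` over the field with two elements. -/
noncomputable def boundary : (G.edgeSet → ZMod 2) →ₗ[ZMod 2] (V → ZMod 2) :=
  Matrix.mulVecLin (Matrix.of fun v e =>
    (if v = D.src e then 1 else 0) + if v = D.tgt e then 1 else 0)

variable {D}

/-- The sum is the pairing of `k` with the boundary of `Z`. -/
lemma sum_boundary {Z : G.edgeSet → ZMod 2} (hZ : D.boundary Z = 0) (k : V → ZMod 2) :
    ∑ e, Z e * (k (D.src e) + k (D.tgt e)) = 0 := by
  have h : ∑ v, k v * D.boundary Z v = 0 := by simp [hZ]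
  rw [← h]
  simp only [boundary, Matrix.mulVecLin_apply, Matrix.mulVec, dotProduct, Matrix.of_apply,
    Finset.mul_sum]
  rw [Finset.sum_comm]
  refine Finset.sum_congr rfl fun e _ => ?_
  have : ∀ v, k v * (((if v = D.src e then 1 else 0) + if v = D.tgt e then 1 else 0) * Z e) =
      (if v = D.src e then Z e * k v else 0) + if v = D.tgt e then Z e * k v else 0 := by
    intro v
    split_ifs <;> ring
  simp_rw [this]
  rw [Finset.sum_add_distrib, Finset.sum_ite_eq', Finset.sum_ite_eq']
  simp [mul_add]

/-- The end terms of `eventually_crossing` telescope along each arc, and what remains at the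
vertices vanishes because `Z` is a cycle. -/
lemma eventually_parity_eq {Z : G.edgeSet → ZMod 2} (hZ : D.boundary Z = 0) {z₀ : ℂ}
    (hz₀ : z₀ ∈ (drawing D.graph)ᶜ) : ∀ᶠ z in 𝓝 z₀, D.parity Z z = D.parity Z z₀ := by
  have h : ∀ᶠ z in 𝓝 z₀, ∀ e : G.edgeSet, ∀ i ∈ Finset.range (D.len e),
      crossing (D.node e i) (D.node e (i + 1)) z = crossing (D.node e i) (D.node e (i + 1)) z₀ +
        (endChange z₀ z (D.node e i) + endChange z₀ z (D.node e (i + 1))) := by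
    rw [Filter.eventually_all]
    intro e
    rw [Filter.eventually_all_finset]
    intro i hi
    have hi := Finset.mem_range.1 hi
    exact eventually_crossing (D.re_ne e i hi) (notMem_segment hz₀ e hi)
  filter_upwards [h] with z hz
  have h2 : ∀ e, Z e * ∑ i ∈ Finset.range (D.len e), crossing (D.node e i) (D.node e (i + 1)) z =
      Z e * ∑ i ∈ Finset.range (D.len e), crossing (D.node e i) (D.node e (i + 1)) z₀ +
        Z e * (endChange z₀ z (D.pos (D.src e)) + endChange z₀ z (D.pos (D.tgt e))) := by
    intro e
    rw [Finset.sum_congr rfl (hz e), Finset.sum_add_distrib,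
      sum_range_add_succ (fun i => endChange z₀ z (D.node e i)), D.node_zero, D.node_len, mul_add]
  unfold parity
  rw [Finset.sum_congr rfl fun e _ => h2 e, Finset.sum_add_distrib,
    sum_boundary hZ (fun v => endChange z₀ z (D.pos v)), add_zero]

lemma parity_eq_of_mem {Z : G.edgeSet → ZMod 2} (hZ : D.boundary Z = 0) {x y z : ℂ}
    (hx : x ∈ connectedComponentIn (drawing D.graph)ᶜ z)
    (hy : y ∈ connectedComponentIn (drawing D.graph)ᶜ z) : D.parity Z x = D.parity Z y := by
  let _ : TopologicalSpace (ZMod 2) := ⊥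
  have : DiscreteTopology (ZMod 2) := ⟨rfl⟩
  refine isPreconnected_connectedComponentIn.constant (f := D.parity Z) (fun w hw => ?_) hx hy
  refine ContinuousAt.continuousWithinAt ?_
  have h := eventually_parity_eq hZ (connectedComponentIn_subset _ _ hw)
  exact (continuousAt_const (y := D.parity Z w)).congr (h.mono fun _ h => h.symm)

lemma exists_parity_jump (Z : G.edgeSet → ZMod 2) (e : G.edgeSet) :
    ∃ t ∈ Set.Ioo (0 : ℝ) 1, ∀ᶠ η : ℝ in 𝓝[>] 0,
      D.parity Z (sidePt (D.node e 0) (D.node e 1) t η) +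
        D.parity Z (sidePt (D.node e 0) (D.node e 1) t (-η)) = Z e := by
  have he := D.len_pos e
  have hre := D.re_ne e 0 he
  simp only [zero_add] at hre
  have hne : (D.node e 1).re - (D.node e 0).re ≠ 0 := sub_ne_zero.2 hre.symm
  have hadj := adj_node (D := D) e he
  simp only [zero_add] at hadj
  -- All but finitely many `t` give a point of the segment with no node on its vertical line. Near
  -- this point the crossings with all other segments are constant.
  have hbad : (⋃ f : G.edgeSet, ⋃ j ∈ Finset.range (D.len f + 1), {t : ℝ |
      (D.node f j).re = (sidePt (D.node e 0) (D.node e 1) t 0).re}).Finite := by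
    refine Set.finite_iUnion fun f => Set.Finite.biUnion (Finset.finite_toSet _) fun j _ => ?_
    refine Set.Subsingleton.finite fun t ht t' ht' => ?_
    have h := (show _ = _ from ht).symm.trans (show _ = _ from ht')
    rw [sidePt_re, sidePt_re] at h
    have h' : ((D.node e 1).re - (D.node e 0).re) * (t - t') = 0 := by linarith
    exact sub_eq_zero.1 ((mul_eq_zero.1 h').resolve_left hne)
  obtain ⟨t, ht, htbad⟩ := (Set.Ioo_infinite (zero_lt_one' ℝ)).exists_notMem_finite hbad
  simp only [Set.mem_iUnion, not_exists] at htbad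
  refine ⟨t, ht, ?_⟩
  set a := D.node e 0
  set b := D.node e 1
  set m := sidePt a b t 0
  have hgood : ∀ f, ∀ j ≤ D.len f, (D.node f j).re ≠ m.re := fun f j hj =>
    htbad f j (Finset.mem_range.2 (by omega))
  have hneg : Filter.Tendsto (fun η : ℝ => sidePt a b t (-η)) (𝓝 0) (𝓝 m) := by
    have : Filter.Tendsto (fun η : ℝ => -η) (𝓝 0) (𝓝 0) := by
      simpa using (continuous_neg (G := ℝ)).tendsto 0
    exact (tendsto_sidePt a b t).comp this
  have h : ∀ᶠ η : ℝ in 𝓝[>] 0, ∀ f : G.edgeSet, ∀ j ∈ Finset.range (D.len f),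
      crossing (D.node f j) (D.node f (j + 1)) (sidePt a b t η) +
        crossing (D.node f j) (D.node f (j + 1)) (sidePt a b t (-η)) =
      if f = e then (if j = 0 then 1 else 0) else 0 := by
    rw [Filter.eventually_all]
    intro f
    rw [Filter.eventually_all_finset]
    intro j hj
    have hj := Finset.mem_range.1 hj
    by_cases hfe : (e, 0) = (f, j)
    · cases hfe
      simpa using eventually_crossing_jump hre ht.1 ht.2
    · have hm : m ∉ segment ℝ (D.node f j) (D.node f (j + 1)) := by
        intro hm
        have hn := sidePt_zero_ne hadj.ne ht.1 ht.2
        rcases (D.cross e 0 he f j hj hfe m (sidePt_zero_mem ht.1 ht.2) hm).1 with h | h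
        · exact hn.1 h
        · exact hn.2 h
      have hc : ∀ᶠ z in 𝓝 m, crossing (D.node f j) (D.node f (j + 1)) z =
          crossing (D.node f j) (D.node f (j + 1)) m := by
        filter_upwards [eventually_crossing (D.re_ne f j hj) hm] with z hz
        rw [hz, endChange_of_ne (hgood f j hj.le), endChange_of_ne (hgood f (j + 1) hj)]
        simp
      filter_upwards [nhdsWithin_le_nhds ((tendsto_sidePt a b t).eventually hc),
        nhdsWithin_le_nhds (hneg.eventually hc)] with η h1 h2
      rw [h1, h2, CharTwo.add_self_eq_zero]
      split_ifs with h3 h4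
      · subst h3 h4
        exact absurd rfl hfe
      · rfl
      · rfl
  filter_upwards [h] with η hη
  unfold parity
  rw [← Finset.sum_add_distrib]
  simp_rw [← mul_add, ← Finset.sum_add_distrib]
  rw [Finset.sum_congr rfl fun f _ => by rw [Finset.sum_congr rfl (hη f)]]
  rw [Finset.sum_eq_single e]
  · simp [he]
  · intro f _ hf
    simp [hf]
  · simp

variable (D) in
/-- The faces on the right of the oriented edges. -/
noncomputable def faces : Finset (Set ℂ) := Finset.univ.image D.dartFace

variable (D) in
/-- The parities of the faces. -/
noncomputable def faceParity : (G.edgeSet → ZMod 2) →ₗ[ZMod 2] (D.faces → ZMod 2) where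
  -- The sample point depends on `F` only, which makes the map linear. The point `0` is a mere
  -- default for an empty set.
  toFun Z F := D.parity Z (if h : F.1.Nonempty then h.some else 0)
  map_add' Z Z' := by
    funext F
    simp only [parity, Pi.add_apply, add_mul, Finset.sum_add_distrib]
  map_smul' c Z := by
    funext F
    simp only [parity, Pi.smul_apply, smul_eq_mul, mul_assoc, Finset.mul_sum, RingHom.id_apply]

lemma parity_sidePt {Z : G.edgeSet → ZMod 2} (hZ : D.boundary Z = 0) {F : Set ℂ}
    (hF : F ∈ D.faces) {z : ℂ} (hz : z ∈ (drawing D.graph)ᶜ)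
    (hzF : connectedComponentIn (drawing D.graph)ᶜ z = F) :
    D.parity Z z = D.faceParity Z ⟨F, hF⟩ := by
  subst hzF
  have hmem := mem_connectedComponentIn hz
  have hne : (connectedComponentIn (drawing D.graph)ᶜ z).Nonempty := ⟨z, hmem⟩
  simp only [faceParity, LinearMap.coe_mk, AddHom.coe_mk, dif_pos hne]
  exact parity_eq_of_mem hZ hmem hne.some_mem

/-- The coefficient of `e` is the sum of the parities of the faces on its two sides. -/
lemma eq_zero_of_faceParity {Z : G.edgeSet → ZMod 2} (hZ : D.boundary Z = 0)
    (h : D.faceParity Z = 0) : Z = 0 := by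
  funext e
  obtain ⟨t, ht, hj⟩ := D.exists_parity_jump Z e
  have hadj := adj_node (D := D) e (D.len_pos e)
  simp only [zero_add] at hadj
  obtain ⟨η, h1, h2, h3⟩ := (hj.and ((D.isPlaneGraph.face_spec hadj t ht).and
    (D.isPlaneGraph.face_spec hadj.symm (1 - t) ⟨by linarith [ht.2], by linarith [ht.1]⟩))).exists
  rw [sidePt_symm] at h3
  have hf1 : face D.graph (D.node e 0) (D.node e 1) ∈ D.faces :=
    Finset.mem_image.2 ⟨(e, true), Finset.mem_univ _, rfl⟩
  have hf2 : face D.graph (D.node e 1) (D.node e 0) ∈ D.faces :=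
    Finset.mem_image.2 ⟨(e, false), Finset.mem_univ _, rfl⟩
  rw [← h1, parity_sidePt hZ hf1 h2.1 h2.2, parity_sidePt hZ hf2 h3.1 h3.2, h]
  simp

variable (D) in
/-- The inequality part of Euler's formula. -/
lemma card_edgeSet_le :
    Fintype.card G.edgeSet ≤ Fintype.card V + D.faces.card := by
  have h1 := LinearMap.finrank_range_add_finrank_ker D.boundary
  have h2 := Submodule.finrank_le (LinearMap.range D.boundary)
  have h3 : Module.finrank (ZMod 2) (LinearMap.ker D.boundary) ≤
      Module.finrank (ZMod 2) (D.faces → ZMod 2) := by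
    refine LinearMap.finrank_le_finrank_of_injective
      (f := D.faceParity.comp (LinearMap.ker D.boundary).subtype) ?_
    rw [injective_iff_map_eq_zero]
    rintro ⟨Z, hZ⟩ h
    exact Subtype.ext (eq_zero_of_faceParity (LinearMap.mem_ker.1 hZ) h)
  rw [Module.finrank_fintype_fun_eq_card] at h1 h2 h3
  rw [Fintype.card_coe] at h3
  omega

/-- In a drawing without triangles and quadrilaterals and with minimum degree at least two, every
face is incident with at least five oriented edges. -/
lemma five_le_card_face (h3 : ∀ a b c, G.Adj a b → G.Adj b c → ¬ G.Adj c a)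
    (h4 : ∀ a b c d, G.Adj a b → G.Adj b c → G.Adj c d → G.Adj d a → a = c ∨ b = d)
    (h2 : ∀ v w, G.Adj v w → ∃ w', w' ≠ w ∧ G.Adj v w') (d₀ : G.edgeSet × Bool) :
    5 ≤ (Finset.univ.filter fun d => D.dartFace d = D.dartFace d₀).card := by
  have hnext : ∀ d, ∃ d', D.tail d' = D.head d ∧ d' ≠ rev d ∧ D.dartFace d' = D.dartFace d := by
    intro d
    refine exists_next_dart d ?_
    obtain ⟨w, hw, hadj⟩ := h2 _ _ (adj_tail_head (D := D) d).symm
    let e : G.edgeSet := ⟨s(D.head d, w), hadj⟩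
    have hne : e ≠ d.1 := by
      intro h
      have h := congrArg Subtype.val h
      rw [edge_eq (D := D) d] at h
      rcases Sym2.eq_iff.1 h with ⟨h', -⟩ | ⟨-, h'⟩
      · exact (adj_tail_head d).ne h'.symm
      · exact hw h'
    rcases Sym2.eq_iff.1 (D.ends e) with ⟨h', -⟩ | ⟨h', -⟩
    · exact ⟨(e, true), h'.symm, hne⟩
    · exact ⟨(e, false), h'.symm, hne⟩
  choose nx ht hne hf using hnext
  have hadj : ∀ d, G.Adj (D.tail d) (D.tail (nx d)) := fun d => by
    rw [ht]; exact adj_tail_head d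
  have hback : ∀ d, D.tail (nx (nx d)) ≠ D.tail d := fun d => by
    rw [ht (nx d)]; exact head_ne_of_ne_rev (ht d) (hne d)
  have htri : ∀ d, D.tail (nx (nx (nx d))) ≠ D.tail d := fun d h =>
    h3 _ _ _ (hadj d) (hadj _) (h ▸ hadj (nx (nx d)))
  have hquad : ∀ d, D.tail (nx (nx (nx (nx d)))) ≠ D.tail d := fun d h => by
    rcases h4 _ _ _ _ (hadj d) (hadj _) (hadj _) (h ▸ hadj (nx (nx (nx d)))) with h' | h'
    · exact hback _ h'.symm
    · exact hback _ h'.symm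
  set d₁ := nx d₀
  set d₂ := nx d₁
  set d₃ := nx d₂
  set d₄ := nx d₃
  -- The walk around the face never turns back, and there are no 3- or 4-cycles. So five consecutive
  -- tails are distinct, and hence so are the five oriented edges.
  have hcard : ({D.tail d₀, D.tail d₁, D.tail d₂, D.tail d₃, D.tail d₄} : Finset V).card = 5 := by
    have a0 := (hadj d₀).ne
    have a1 := (hadj d₁).ne
    have a2 := (hadj d₂).ne
    have a3 := (hadj d₃).ne
    have b0 := (hback d₀).symm
    have b1 := (hback d₁).symm
    have b2 := (hback d₂).symm
    have c0 := (htri d₀).symm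
    have c1 := (htri d₁).symm
    have e0 := (hquad d₀).symm
    rw [Finset.card_insert_of_notMem, Finset.card_insert_of_notMem, Finset.card_insert_of_notMem,
      Finset.card_insert_of_notMem, Finset.card_singleton]
    all_goals simp only [Finset.mem_insert, Finset.mem_singleton, not_or]
    exacts [a3, ⟨a2, b2⟩, ⟨a1, b1, c1⟩, ⟨a0, b0, c0, e0⟩]
  rw [← hcard]
  refine (Finset.card_le_card ?_).trans (Finset.card_image_le (f := D.tail))
  intro v hv
  simp only [Finset.mem_insert, Finset.mem_singleton] at hv
  simp only [Finset.mem_image, Finset.mem_filter, Finset.mem_univ, true_and]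
  have f1 : D.dartFace d₁ = D.dartFace d₀ := hf d₀
  have f2 : D.dartFace d₂ = D.dartFace d₀ := (hf d₁).trans f1
  have f3 : D.dartFace d₃ = D.dartFace d₀ := (hf d₂).trans f2
  have f4 : D.dartFace d₄ = D.dartFace d₀ := (hf d₃).trans f3
  rcases hv with rfl | rfl | rfl | rfl | rfl
  exacts [⟨_, rfl, rfl⟩, ⟨_, f1, rfl⟩, ⟨_, f2, rfl⟩, ⟨_, f3, rfl⟩, ⟨_, f4, rfl⟩]

lemma three_mul_card_edgeSet_le (D : PolylineDrawing G)
    (h3 : ∀ a b c, G.Adj a b → G.Adj b c → ¬ G.Adj c a)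
    (h4 : ∀ a b c d, G.Adj a b → G.Adj b c → G.Adj c d → G.Adj d a → a = c ∨ b = d)
    (h2 : ∀ v w, G.Adj v w → ∃ w', w' ≠ w ∧ G.Adj v w') :
    3 * Fintype.card G.edgeSet ≤ 5 * Fintype.card V := by
  -- The `2|E|` oriented edges are partitioned by the face on their right; together with `|E| ≤ |V|
  -- + |F|` this gives the claim.
  have h : D.faces.card * 5 ≤ (Finset.univ : Finset (G.edgeSet × Bool)).card := by
    rw [Finset.card_eq_sum_card_image D.dartFace, ← smul_eq_mul]
    refine Finset.card_nsmul_le_sum _ _ _ fun F hF => ?_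
    obtain ⟨d, -, rfl⟩ := Finset.mem_image.1 hF
    exact five_le_card_face h3 h4 h2 d
  have h' := D.card_edgeSet_le
  rw [Finset.card_univ, Fintype.card_prod, Fintype.card_bool] at h
  omega

end PolylineDrawing

/-! ### Nodes and segments of a simple polygonal arc -/

section PolygonalArc

variable {n : ℕ} {p : ℕ → Plane} (h1 : ∀ i < n, p i ≠ p (i + 1))
  (h2 : ∀ i, i + 1 < n →
    segment ℝ (p i) (p (i + 1)) ∩ segment ℝ (p (i + 1)) (p (i + 2)) = {p (i + 1)})
  (h3 : ∀ i j, i + 1 < j → j < n →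
    Disjoint (segment ℝ (p i) (p (i + 1))) (segment ℝ (p j) (p (j + 1))))

include h2 h3 in
lemma arc_cross {i j : ℕ} (hi : i < n) (hj : j < n) (hij : i ≠ j) {x : Plane}
    (hx : x ∈ segment ℝ (p i) (p (i + 1))) (hx' : x ∈ segment ℝ (p j) (p (j + 1))) :
    (x = p i ∨ x = p (i + 1)) ∧ (x = p j ∨ x = p (j + 1)) := by
  wlog hlt : i < j generalizing i j
  · exact (this hj hi hij.symm hx' hx (by omega)).symm
  rcases Nat.lt_or_ge (i + 1) j with h | h
  · exact absurd hx' (Set.disjoint_left.1 (h3 i j h hj) hx)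
  · obtain rfl : j = i + 1 := by omega
    have h := (h2 i hj).subset ⟨hx, hx'⟩
    exact ⟨Or.inr h, Or.inl h⟩

include h1 h2 h3 in
lemma arc_injOn {i j : ℕ} (hi : i ≤ n) (hj : j ≤ n) (h : p i = p j) : i = j := by
  by_contra hij
  wlog hlt : i < j generalizing i j
  · exact this hj hi h.symm (Ne.symm hij) (by omega)
  obtain ⟨k, rfl⟩ : ∃ k, j = k + 1 := ⟨j - 1, by omega⟩
  have hik : p i ∈ segment ℝ (p k) (p (k + 1)) := h ▸ right_mem_segment ℝ _ _
  rcases Nat.lt_trichotomy (i + 1) k with h' | h' | h'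
  · exact Set.disjoint_left.1 (h3 i k h' (by omega)) (left_mem_segment ℝ _ _) hik
  · subst h'
    exact h1 i (by omega) ((h2 i (by omega)).subset ⟨left_mem_segment ℝ _ _, hik⟩)
  · obtain rfl : i = k := by omega
    exact h1 i (by omega) h

include h1 h2 h3 in
lemma arc_first {i : ℕ} (hi : i < n) (h : p 0 ∈ segment ℝ (p i) (p (i + 1))) : i = 0 := by
  by_contra h0
  rcases (arc_cross h2 h3 (by omega : 0 < n) hi (Ne.symm h0) (left_mem_segment ℝ _ _) h).2
    with h' | h'
  · exact h0 (arc_injOn h1 h2 h3 (Nat.zero_le _) hi.le h').symm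
  · have := arc_injOn h1 h2 h3 (Nat.zero_le _) hi h'
    omega

include h1 h2 h3 in
lemma arc_last {i : ℕ} (hi : i < n) (h : p n ∈ segment ℝ (p i) (p (i + 1))) : i + 1 = n := by
  by_contra h0
  obtain ⟨k, rfl⟩ : ∃ k, n = k + 1 := ⟨n - 1, by omega⟩
  rcases (arc_cross h2 h3 (Nat.lt_succ_self k) hi (by omega) (right_mem_segment ℝ _ _) h).2
    with h' | h'
  · have := arc_injOn h1 h2 h3 le_rfl hi.le h'
    omega
  · have := arc_injOn h1 h2 h3 le_rfl hi h'
    omega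

end PolygonalArc

/-! ### Removing vertical segments by a shear -/

section Shear

/-- The plane as the complex plane, sheared in horizontal direction. -/
noncomputable def shear (s : ℝ) : Plane →ₗ[ℝ] ℂ where
  toFun x := ⟨x 0 - s * x 1, x 1⟩
  map_add' x y := by
    apply Complex.ext <;> simp
    ring
  map_smul' c x := by
    apply Complex.ext <;> simp
    ring

lemma shear_injective (s : ℝ) : Function.Injective (shear s) := by
  intro x y h
  have h1 : x 1 = y 1 := congrArg Complex.im h
  have h0 : x 0 - s * x 1 = y 0 - s * y 1 := congrArg Complex.re h
  ext i
  fin_cases i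
  · simp only [h1] at h0
    simpa using h0
  · exact h1

lemma exists_mem_segment_of_shear {s : ℝ} {a b : Plane} {z : ℂ}
    (hz : z ∈ segment ℝ (shear s a) (shear s b)) : ∃ x ∈ segment ℝ a b, shear s x = z := by
  have h := image_segment ℝ (shear s).toAffineMap a b
  simp only [LinearMap.coe_toAffineMap] at h
  rw [← h] at hz
  exact hz

/-- At most one shear makes the segment between two distinct points vertical. -/
lemma finite_shear_re_eq {a b : Plane} (h : a ≠ b) :
    {s : ℝ | (shear s a).re = (shear s b).re}.Finite := by
  refine Set.Subsingleton.finite fun s hs t ht => ?_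
  have hs' : a 0 - s * a 1 = b 0 - s * b 1 := hs
  have ht' : a 0 - t * a 1 = b 0 - t * b 1 := ht
  by_contra hst
  have h1 : (s - t) * (a 1 - b 1) = 0 := by linarith
  have h1' : a 1 = b 1 := sub_eq_zero.1 ((mul_eq_zero.1 h1).resolve_left (sub_ne_zero.2 hst))
  apply h
  ext i
  fin_cases i
  · rw [h1'] at hs'
    simpa using hs'
  · exact h1'

end Shear

/-! ### From planar embeddings of large girth to sparsity -/

section Embedding

variable {V : Type*} {G : SimpleGraph V}

lemma PlanarEmbedding.nonempty_polylineDrawing [Finite V] (D : PlanarEmbedding G) :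
    Nonempty (PolylineDrawing G) := by
  have : Finite G.edgeSet := Set.toFinite _
  let src : G.edgeSet → V := fun e => (Quot.out e.1).1
  let tgt : G.edgeSet → V := fun e => (Quot.out e.1).2
  have ends : ∀ e : G.edgeSet, (e : Sym2 V) = s(src e, tgt e) := fun e =>
    (Quot.out_eq e.1).symm
  have hadj : ∀ e, G.Adj (src e) (tgt e) := fun e => by
    have := e.2
    rwa [ends e, SimpleGraph.mem_edgeSet] at this
  have harc := fun e => D.isPolygonalArc _ _ (hadj e)
  choose n p hn hp0 hpn h1 h2 h3 hA using harc
  have hmem : ∀ e, ∀ i < n e, segment ℝ (p e i) (p e (i + 1)) ⊆ D.arc e.1 := by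
    intro e i hi
    rw [ends e, hA e]
    exact Set.subset_biUnion_of_mem (u := fun i => segment ℝ (p e i) (p e (i + 1))) hi
  have hnode : ∀ e, ∀ i ≤ n e, p e i ∈ D.arc e.1 := by
    intro e i hi
    rcases Nat.lt_or_ge i (n e) with h | h
    · exact hmem e i h (left_mem_segment ℝ _ _)
    · obtain ⟨k, rfl⟩ : ∃ k, i = k + 1 := ⟨i - 1, by have := hn e; omega⟩
      exact hmem e k hi (right_mem_segment ℝ _ _)
  have hcommon : ∀ e f : G.edgeSet, e ≠ f → ∀ x ∈ D.arc e.1, x ∈ D.arc f.1 →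
      x = p e 0 ∨ x = p e (n e) := by
    intro e f hef x hx hx'
    obtain ⟨w, hw, -, rfl⟩ := D.arc_inter e.1 e.2 f.1 f.2 (fun h => hef (Subtype.ext h)) x ⟨hx, hx'⟩
    rw [ends e, Sym2.mem_iff] at hw
    rw [hp0, hpn]
    exact hw.imp (congrArg _) (congrArg _)
  have hbad : (⋃ e, ⋃ i ∈ Finset.range (n e),
      {s : ℝ | (shear s (p e i)).re = (shear s (p e (i + 1))).re}).Finite :=
    Set.finite_iUnion fun e => Set.Finite.biUnion (Finset.finite_toSet _) fun i hi =>
      finite_shear_re_eq (h1 e i (Finset.mem_range.1 hi))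
  obtain ⟨s, hs⟩ := hbad.infinite_compl.nonempty
  simp only [Set.mem_compl_iff, Set.mem_iUnion, not_exists] at hs
  -- Different arcs share only ends of arcs, and an end of an arc lies on its first or last segment
  -- only, as an end of that segment.
  have hseg : ∀ e f : G.edgeSet, e ≠ f → ∀ i < n e, ∀ x ∈ segment ℝ (p e i) (p e (i + 1)),
      x ∈ D.arc f.1 → x = p e i ∨ x = p e (i + 1) := by
    intro e f hef i hi x hx hx'
    rcases hcommon e f hef x (hmem e i hi hx) hx' with rfl | rfl
    · left; rw [arc_first (h1 e) (h2 e) (h3 e) hi hx]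
    · right; rw [arc_last (h1 e) (h2 e) (h3 e) hi hx]
  refine ⟨{
    pos := fun v => shear s (D.pos v)
    src := src
    tgt := tgt
    len := n
    node := fun e i => shear s (p e i)
    ends := ends
    pos_injective := (shear_injective s).comp D.pos_injective
    len_pos := hn
    node_zero := fun e => by rw [hp0]
    node_len := fun e => by rw [hpn]
    re_ne := fun e i hi => hs e i (Finset.mem_range.2 hi)
    cross := ?_
    node_eq := ?_ }⟩
  · intro e i hi f j hj hne z hz hz'
    obtain ⟨x, hx, rfl⟩ := exists_mem_segment_of_shear hz
    obtain ⟨y, hy, hxy⟩ := exists_mem_segment_of_shear hz'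
    obtain rfl := shear_injective s hxy
    simp only [(shear_injective s).eq_iff]
    by_cases hef : e = f
    · subst hef
      exact arc_cross (h2 e) (h3 e) hi hj (fun h => hne (by rw [h])) hx hy
    · exact ⟨hseg e f hef i hi _ hx (hmem f j hj hy),
        hseg f e (Ne.symm hef) j hj _ hy (hmem e i hi hx)⟩
  · intro e i hi f j hj h
    have h := shear_injective s h
    by_cases hef : e = f
    · subst hef
      left
      rw [arc_injOn (h1 e) (h2 e) (h3 e) hi hj h]
    · right
      have hends : ∀ e f : G.edgeSet, e ≠ f → ∀ i ≤ n e, p e i ∈ D.arc f.1 → i = 0 ∨ i = n e := by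
        intro e f hef i hi hx
        rcases hcommon e f hef _ (hnode e i hi) hx with h | h
        · exact Or.inl (arc_injOn (h1 e) (h2 e) (h3 e) hi (Nat.zero_le _) h)
        · exact Or.inr (arc_injOn (h1 e) (h2 e) (h3 e) hi le_rfl h)
      exact ⟨hends e f hef i hi (h ▸ hnode f j hj), hends f e (Ne.symm hef) j hj (h ▸ hnode e i hi)⟩

/-- The restriction of a planar embedding to an induced subgraph. -/
def PlanarEmbedding.induce (D : PlanarEmbedding G) (s : Set V) :
    PlanarEmbedding (G.induce s) where
  pos v := D.pos v
  arc e := D.arc (e.map Subtype.val)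
  pos_injective := D.pos_injective.comp Subtype.val_injective
  isPolygonalArc u v h := D.isPolygonalArc u v h
  vertex_mem_arc e he w hw := by
    induction e with
    | h a b =>
      have h := D.vertex_mem_arc s(a.1, b.1) he w.1 hw
      rw [Sym2.mem_iff] at h ⊢
      exact h.imp Subtype.ext Subtype.ext
  arc_inter e he f hf hef x hx := by
    induction e with
    | h a b =>
      induction f with
      | h c d =>
        have hne : s(a.1, b.1) ≠ s(c.1, d.1) := fun h =>
          hef (Sym2.map.injective Subtype.val_injective h)
        obtain ⟨w, hw, hw', rfl⟩ := D.arc_inter s(a.1, b.1) he s(c.1, d.1) hf hne x hx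
        rw [Sym2.mem_iff] at hw hw'
        rcases hw with rfl | rfl
        · refine ⟨a, Sym2.mem_mk_left _ _, ?_, rfl⟩
          rw [Sym2.mem_iff]
          exact hw'.imp Subtype.ext Subtype.ext
        · refine ⟨b, Sym2.mem_mk_right _ _, ?_, rfl⟩
          rw [Sym2.mem_iff]
          exact hw'.imp Subtype.ext Subtype.ext

lemma not_adj_of_five_le_egirth (hG : 5 ≤ G.egirth) (a b c : V) (hab : G.Adj a b)
    (hbc : G.Adj b c) : ¬ G.Adj c a := by
  intro hca
  have h := SimpleGraph.le_egirth.1 hG a (.cons hab (.cons hbc (.cons hca .nil))) (by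
    rw [SimpleGraph.Walk.isCycle_def]
    simp [SimpleGraph.Walk.isTrail_def, hab.ne, hbc.ne, hca.ne, hab.ne', hca.ne'])
  norm_num at h

lemma eq_or_eq_of_five_le_egirth (hG : 5 ≤ G.egirth) (a b c d : V) (hab : G.Adj a b)
    (hbc : G.Adj b c) (hcd : G.Adj c d) (hda : G.Adj d a) : a = c ∨ b = d := by
  by_contra hne
  push Not at hne
  obtain ⟨hac, hbd⟩ := hne
  have h := SimpleGraph.le_egirth.1 hG a (.cons hab (.cons hbc (.cons hcd (.cons hda .nil)))) (by
    rw [SimpleGraph.Walk.isCycle_def]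
    simp [SimpleGraph.Walk.isTrail_def, hab.ne, hbc.ne, hcd.ne, hda.ne, hab.ne', hda.ne', hac, hbd,
      hac.symm])
  norm_num at h

/-- Minimum degree three in `W` supplies the second neighbor that the face count needs. From `3|E| ≤
5|V|`, the degree sum times 5 is `10|E| ≤ 50|V|/3 < 17|V|`. -/
lemma isSparse_of_isPlanar [Finite V] (hG : IsPlanar G) (hg : 5 ≤ G.egirth) : IsSparse G := by
  have := Fintype.ofFinite V
  obtain ⟨E⟩ := hG
  intro W hW h3
  obtain ⟨D⟩ := (E.induce (W : Set V)).nonempty_polylineDrawing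
  set G' := G.induce (W : Set V)
  have hcard := D.three_mul_card_edgeSet_le
    (fun a b c => not_adj_of_five_le_egirth hg a.1 b.1 c.1)
    (fun a b c d h1 h2 h3 h4 => (eq_or_eq_of_five_le_egirth hg a.1 b.1 c.1 d.1 h1 h2 h3 h4).imp
      Subtype.ext Subtype.ext)
    (fun v w _ => by
      have hlt : 0 < ((nbrs G W v.1).erase w.1).card := by
        have := Finset.pred_card_le_card_erase (s := nbrs G W v.1) (a := w.1)
        have := h3 v.1 v.2
        omega
      obtain ⟨w', hw'⟩ := Finset.card_pos.1 hlt
      rw [Finset.mem_erase, mem_nbrs] at hw'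
      exact ⟨⟨w', hw'.2.1⟩, fun h => hw'.1 (congrArg Subtype.val h), hw'.2.2⟩)
  have hdeg : ∑ v ∈ W, (nbrs G W v).card = 2 * Fintype.card G'.edgeSet := by
    rw [← SimpleGraph.edgeFinset_card, ← SimpleGraph.sum_degrees_eq_twice_card_edges,
      ← Finset.sum_coe_sort]
    refine Finset.sum_congr rfl fun v _ => ?_
    rw [← SimpleGraph.card_neighborFinset_eq_degree,
      ← Finset.card_map (Function.Embedding.subtype _)]
    congr 1
    ext w
    simp [mem_nbrs, G', and_comm]
  have hcW : Fintype.card (W : Set V) = W.card := by simp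
  have := Finset.card_pos.2 hW
  rw [hdeg]
  omega

end Embedding

end SparseRecoloring

theorem theorem2 {V : Type*} [Finite V] {C : Type*} (G : SimpleGraph V) :
    (SparseRecoloring.mad G < 17 / 5 →
      ∀ L : V → Finset C, SparseRecoloring.IsKAssignment 6 L →
        ∀ α β : SparseRecoloring.LColoring G L,
          ∃ σ : SparseRecoloring.RecoloringSequence G L α β, SparseRecoloring.IsGood 12 σ) ∧
    (SparseRecoloring.IsPlanar G → 5 ≤ G.egirth →
      ∀ L : V → Finset C, SparseRecoloring.IsKAssignment 6 L →
        ∀ α β : SparseRecoloring.LColoring G L,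
          ∃ σ : SparseRecoloring.RecoloringSequence G L α β, SparseRecoloring.IsGood 12 σ) :=
  ⟨fun h _ hL α β =>
    SparseRecoloring.exists_isGood_of_isSparse (SparseRecoloring.isSparse_of_mad_lt h) hL α β,
   fun hp hg _ hL α β =>
    SparseRecoloring.exists_isGood_of_isSparse (SparseRecoloring.isSparse_of_isPlanar hp hg) hL α β⟩
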